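/- For a finite simple graph $G$ let $Q(G)=D(G)+A(G)$ be its signless Laplacian matrix, where $D(G)$ is the diagonal matrix of vertex degrees and $A(G)$ is the adjacency matrix, and let $q(G)$ be the largest eigenvalue of $Q(G)$. Let $T_{n,k}$ be the $k$-partite Turán graph on $n$ vertices, i.e. the complete $k$-partite graph whose part sizes differ pairwise by at most $1$. For $t\ge 2$ let $K_k^+[t]$ be the graph obtained from the complete $k$-partite graph with all parts of size $t$ by adding exactly one edge inside one part. For every integer $k\ge 3$ there exist a real constant $c>0$ and an integer $n_0$, both depending only on $k$, such that for every $n\ge n_0$ the following holds: if $G$ is an $n$-vertex graph with $q(G)\ge q(T_{n,k})$ and $G$ is not isomorphic to $T_{n,k}$, then there is an integer $t\ge 2$ with $t\ge c\log n$ such that $G$ contains a (not necessarily induced) subgraph isomorphic to $K_k^+[t]$. -/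

import Mathlib

namespace SignlessTuran

open SimpleGraph

section Spectral

variable {V : Type*} [Fintype V] [DecidableEq V] (G : SimpleGraph V) [DecidableRel G.Adj]

/-- The signless Laplacian matrix `Q(G) = D(G) + A(G)`. -/
def signlessLapMatrix : Matrix V V ℝ := G.degMatrix ℝ + G.adjMatrix ℝ

/-- The signless Laplacian spectral radius `q(G)`: the largest eigenvalue of `Q(G)`
(for a nonempty vertex set it is attained, see `isGreatest_signlessRadius`). -/
noncomputable def signlessRadius : ℝ :=
  sSup {μ : ℝ | Module.End.HasEigenvalue (Matrix.toLin' (signlessLapMatrix G)) μ}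

theorem isHermitian_signlessLapMatrix : (signlessLapMatrix G).IsHermitian :=
  (G.isHermitian_degMatrix ℝ).add (G.isHermitian_adjMatrix ℝ)

/-- The supremum defining `q(G)` is a maximum, so `q(G)` is the largest eigenvalue of `Q(G)`. -/
theorem isGreatest_signlessRadius [Nonempty V] :
    IsGreatest {μ : ℝ | Module.End.HasEigenvalue (Matrix.toLin' (signlessLapMatrix G)) μ}
      (signlessRadius G) := by
  set S := {μ : ℝ | Module.End.HasEigenvalue (Matrix.toLin' (signlessLapMatrix G)) μ} with hS
  have hspec : S = spectrum ℝ (signlessLapMatrix G) := by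
    ext μ
    rw [hS, Set.mem_ofPred_eq, Module.End.hasEigenvalue_iff_mem_spectrum, Matrix.spectrum_toLin']
  have hfin : S.Finite := Module.End.finite_hasEigenvalue _
  have hne : S.Nonempty := by
    rw [hspec]
    exact ⟨_, (isHermitian_signlessLapMatrix G).eigenvalues_mem_spectrum_real
      (Classical.arbitrary V)⟩
  exact ⟨hne.csSup_mem hfin, fun μ hμ => le_csSup hfin.bddAbove hμ⟩

end Spectral

/-- The graph `K_k^+[t]`: the complete `k`-partite graph with parts `{i} × Fin t` of size `t`,
together with the single edge joining the vertices `(0, 0)` and `(0, 1)` of part `0`.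
(The extra edge exists exactly when `1 ≤ k` and `2 ≤ t`.) -/
def multipartitePlus (k t : ℕ) : SimpleGraph (Fin k × Fin t) :=
  completeEquipartiteGraph k t ⊔
    SimpleGraph.fromRel (fun v w =>
      v.1.val = 0 ∧ v.2.val = 0 ∧ w.1.val = 0 ∧ w.2.val = 1)

theorem multipartitePlus_adj {k t : ℕ} (v w : Fin k × Fin t) :
    (multipartitePlus k t).Adj v w ↔
      v.1 ≠ w.1 ∨ (v.1.val = 0 ∧ w.1.val = 0 ∧
        ((v.2.val = 0 ∧ w.2.val = 1) ∨ (v.2.val = 1 ∧ w.2.val = 0))) := by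
  simp only [multipartitePlus, sup_adj, completeEquipartiteGraph_adj, fromRel_adj]
  constructor
  · rintro (h | ⟨-, h | h⟩)
    · exact Or.inl h
    · exact Or.inr (by tauto)
    · exact Or.inr (by tauto)
  · rintro (h | h)
    · exact Or.inl h
    · refine Or.inr ⟨?_, by tauto⟩
      rintro rfl
      omega

end SignlessTuran

namespace SignlessTuran

open SimpleGraph Matrix

set_option linter.unusedSectionVars false

/-! ### Rayleigh quotients and Perron-type facts for the signless Laplacian -/

section Spectral

variable {V : Type*} [Fintype V] [DecidableEq V] (G : SimpleGraph V) [DecidableRel G.Adj]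

/-! Fix a small `κ` depending on `k` and let `S` maximize `q(G[S]) / |S| + κ log |S|`
(`exists_dense_induced`). Since `q(G[S]) ≤ 2|S|`, the logarithm forces `|S|` to be linear in `n`,
while the density `q(G[S]) / |S|` is at least `q(G) / n ≥ 2(1 - 1/k) - k/n²`. Optimality against
deleting the vertex with the smallest entry of a nonnegative top eigenvector forces that eigenvector
to be nearly flat, and then every degree in `G[S]` is at least about `q(G[S]) / 2`, hence at least
`(1 - 1/k - 1/(4k⁴))|S|`.

If `G[S]` contains `K_{k+1}`, two vertices `u, v` of this clique have noticeably more than `(1 -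
2/k)|S|` common neighbours. Repeated pigeonholing builds a complete `(k-1)`-partite graph with parts
of logarithmic size among those common neighbours. One more part, into which `u` and `v` are
inserted, gives `K_k^+[t]` (`isContained_of_not_cliqueFree`).

If `G[S]` is `K_{k+1}`-free, the Andrásfai–Erdős–Sós theorem makes it `k`-colourable, so `q(G[S]) ≤
2(1 - 1/k)|S|`. For `S ≠ V` the logarithmic gain, at least `κ/n`, exceeds the deficit `k/n²`, a
contradiction. So `G` itself is `k`-colourable, and the Turán graph is the unique maximizer of `q`
among such graphs (`nonempty_iso_turanGraph_of_coloring`), by comparing secular equations of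
complete multipartite graphs. -/

theorem signlessLapMatrix_mulVec (x : V → ℝ) (v : V) :
    (signlessLapMatrix G *ᵥ x) v = ∑ w, if G.Adj v w then x v + x w else 0 := by
  simp only [signlessLapMatrix, Matrix.add_mulVec, Pi.add_apply, degMatrix,
    Matrix.mulVec_diagonal, SimpleGraph.adjMatrix_mulVec_apply]
  rw [← Finset.sum_filter, Finset.sum_add_distrib, Finset.sum_const, nsmul_eq_mul,
    ← neighborFinset_eq_filter, card_neighborFinset_eq_degree]

theorem two_mul_dotProduct_signlessLapMatrix (x : V → ℝ) :
    2 * (x ⬝ᵥ (signlessLapMatrix G *ᵥ x)) =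
      ∑ v, ∑ w, if G.Adj v w then (x v + x w) ^ 2 else 0 := by
  have h1 : x ⬝ᵥ (signlessLapMatrix G *ᵥ x) =
      ∑ v, ∑ w, if G.Adj v w then x v * (x v + x w) else 0 := by
    simp only [dotProduct, signlessLapMatrix_mulVec, Finset.mul_sum, mul_ite, mul_zero]
  have h2 : x ⬝ᵥ (signlessLapMatrix G *ᵥ x) =
      ∑ v, ∑ w, if G.Adj v w then x w * (x v + x w) else 0 := by
    rw [h1, Finset.sum_comm]
    refine Finset.sum_congr rfl fun v _ => Finset.sum_congr rfl fun w _ => ?_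
    simp only [G.adj_comm w v, add_comm (x w)]
  rw [two_mul]
  nth_rewrite 1 [h1]
  rw [h2, ← Finset.sum_add_distrib]
  refine Finset.sum_congr rfl fun v _ => ?_
  rw [← Finset.sum_add_distrib]
  refine Finset.sum_congr rfl fun w _ => ?_
  split_ifs <;> ring

theorem le_signlessRadius_of_eigenvector [Nonempty V] {μ : ℝ} {x : V → ℝ} (hx : x ≠ 0)
    (h : signlessLapMatrix G *ᵥ x = μ • x) : μ ≤ signlessRadius G := by
  refine (isGreatest_signlessRadius G).2 ?_
  refine Module.End.hasEigenvalue_of_hasEigenvector (x := x) ?_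
  exact ⟨Module.End.mem_eigenspace_iff.2 (by simpa using h), hx⟩

/-- An eigenvector of `qI - Q` with eigenvalue `s` is an eigenvector of `Q` with eigenvalue `q - s`,
which cannot exceed `q`. -/
theorem posSemidef_signlessRadius_sub [Nonempty V] :
    (signlessRadius G • (1 : Matrix V V ℝ) - signlessLapMatrix G).PosSemidef := by
  have hH : (signlessRadius G • (1 : Matrix V V ℝ) - signlessLapMatrix G).IsHermitian := by
    refine Matrix.IsHermitian.sub ?_ (isHermitian_signlessLapMatrix G)
    simp [Matrix.IsHermitian]
  rw [hH.posSemidef_iff_eigenvalues_nonneg]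
  intro i
  have h := hH.mulVec_eigenvectorBasis i
  have hne : (hH.eigenvectorBasis i).ofLp ≠ 0 := by
    have := hH.eigenvectorBasis.orthonormal.ne_zero i
    intro h0
    exact this (by ext j; exact congrFun h0 j)
  rw [Matrix.sub_mulVec, Matrix.smul_mulVec, Matrix.one_mulVec, sub_eq_iff_eq_add] at h
  have := le_signlessRadius_of_eigenvector G (μ := signlessRadius G - hH.eigenvalues i) hne (by
    rw [sub_smul, h]; abel)
  simpa using this

theorem dotProduct_signlessLapMatrix_le [Nonempty V] (x : V → ℝ) :
    x ⬝ᵥ (signlessLapMatrix G *ᵥ x) ≤ signlessRadius G * ∑ v, x v ^ 2 := by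
  have h := (posSemidef_signlessRadius_sub G).dotProduct_mulVec_nonneg x
  rw [Matrix.sub_mulVec, Matrix.smul_mulVec, Matrix.one_mulVec, dotProduct_sub,
    dotProduct_smul] at h
  have h2 : x ⬝ᵥ x = ∑ v, x v ^ 2 := by simp [dotProduct, sq]
  simp only [star_trivial, smul_eq_mul, h2] at h
  linarith

theorem sum_sq_le_signlessRadius [Nonempty V] (x : V → ℝ) :
    (∑ v, ∑ w, if G.Adj v w then (x v + x w) ^ 2 else 0) ≤
      2 * signlessRadius G * ∑ v, x v ^ 2 := by
  rw [← two_mul_dotProduct_signlessLapMatrix]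
  linarith [dotProduct_signlessLapMatrix_le G x]

/-- A nonnegative unit eigenvector for the largest eigenvalue of `Q(G)`. -/
theorem exists_nonneg_eigenvector [Nonempty V] :
    ∃ x : V → ℝ, (∀ v, 0 ≤ x v) ∧ ∑ v, x v ^ 2 = 1 ∧
      signlessLapMatrix G *ᵥ x = signlessRadius G • x := by
  obtain ⟨z, hz⟩ := (isGreatest_signlessRadius G).1.exists_hasEigenvector
  have hz0 : z ≠ 0 := hz.2
  have hze : signlessLapMatrix G *ᵥ z = signlessRadius G • z := by
    simpa using Module.End.mem_eigenspace_iff.1 hz.1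
  have hpos : 0 < ∑ v, z v ^ 2 := by
    obtain ⟨v, hv⟩ := Function.ne_iff.1 hz0
    exact Finset.sum_pos' (fun _ _ => sq_nonneg _) ⟨v, Finset.mem_univ _, by
      have : z v ≠ 0 := hv
      positivity⟩
  set N := Real.sqrt (∑ v, z v ^ 2) with hN
  have hN2 : N ^ 2 = ∑ v, z v ^ 2 := Real.sq_sqrt hpos.le
  have hN0 : 0 < N := Real.sqrt_pos.2 hpos
  set y : V → ℝ := fun v => |z v| with hy
  have hyy : ∑ v, y v ^ 2 = ∑ v, z v ^ 2 := by simp [hy]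
  have hPSD := posSemidef_signlessRadius_sub G
  -- Passing to absolute values does not decrease the quadratic form of `Q`, so the positive
  -- semidefinite form of `qI - Q` vanishes at `y`, which places `y` in the kernel.
  have hyQ : (signlessRadius G • (1 : Matrix V V ℝ) - signlessLapMatrix G) *ᵥ y = 0 := by
    rw [← hPSD.dotProduct_mulVec_zero_iff]
    refine le_antisymm ?_ (hPSD.dotProduct_mulVec_nonneg y)
    have h1 := two_mul_dotProduct_signlessLapMatrix G z
    have h2 := two_mul_dotProduct_signlessLapMatrix G y
    have h3 : z ⬝ᵥ (signlessLapMatrix G *ᵥ z) = signlessRadius G * ∑ v, z v ^ 2 := by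
      rw [hze, dotProduct_smul, smul_eq_mul]; simp [dotProduct, sq]
    have h4 : (∑ v, ∑ w, if G.Adj v w then (z v + z w) ^ 2 else 0) ≤
        ∑ v, ∑ w, if G.Adj v w then (y v + y w) ^ 2 else 0 := by
      refine Finset.sum_le_sum fun v _ => Finset.sum_le_sum fun w _ => ?_
      split_ifs
      · rw [← sq_abs (z v + z w)]
        exact pow_le_pow_left₀ (abs_nonneg _) (abs_add_le _ _) 2
      · exact le_rfl
    have h5 : y ⬝ᵥ y = ∑ v, y v ^ 2 := by simp [dotProduct, sq]
    simp only [star_trivial, Matrix.sub_mulVec, Matrix.smul_mulVec, Matrix.one_mulVec,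
      dotProduct_sub, dotProduct_smul, smul_eq_mul, h5, hyy]
    linarith
  have hyQ' : signlessLapMatrix G *ᵥ y = signlessRadius G • y := by
    rw [Matrix.sub_mulVec, Matrix.smul_mulVec, Matrix.one_mulVec, sub_eq_zero] at hyQ
    exact hyQ.symm
  refine ⟨N⁻¹ • y, fun v => by simp only [Pi.smul_apply, smul_eq_mul, hy]; positivity, ?_, ?_⟩
  · simp only [Pi.smul_apply, smul_eq_mul, mul_pow, ← Finset.mul_sum, hyy, ← hN2]
    field_simp
  · rw [Matrix.mulVec_smul, hyQ', smul_comm]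

/-- A positive vector `y` with `Q y ≤ lam y` bounds the largest eigenvalue by `lam`; in case of
equality `Q y = lam y` on the support of any nonnegative top eigenvector. -/
theorem signlessRadius_le_of_mulVec_le [Nonempty V] {y : V → ℝ} (hy : ∀ v, 0 < y v) {lam : ℝ}
    (h : ∀ v, (signlessLapMatrix G *ᵥ y) v ≤ lam * y v) :
    signlessRadius G ≤ lam ∧ (lam ≤ signlessRadius G → ∀ x : V → ℝ, (∀ v, 0 ≤ x v) →
      signlessLapMatrix G *ᵥ x = signlessRadius G • x →
        ∀ v, 0 < x v → (signlessLapMatrix G *ᵥ y) v = lam * y v) := by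
  have key : ∀ x : V → ℝ, signlessLapMatrix G *ᵥ x = signlessRadius G • x →
      ∑ v, x v * (signlessLapMatrix G *ᵥ y) v = signlessRadius G * ∑ v, x v * y v := by
    intro x hx
    have h1 : x ⬝ᵥ (signlessLapMatrix G *ᵥ y) = (signlessLapMatrix G *ᵥ x) ⬝ᵥ y := by
      rw [Matrix.dotProduct_mulVec, ← Matrix.mulVec_transpose]
      congr 2
      simpa using (isHermitian_signlessLapMatrix G).eq
    rw [hx, smul_dotProduct, smul_eq_mul] at h1
    simpa [dotProduct] using h1
  have hle : signlessRadius G ≤ lam := by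
    obtain ⟨x, hx0, hx1, hx⟩ := exists_nonneg_eigenvector G
    have hpos : 0 < ∑ v, x v * y v := by
      refine Finset.sum_pos' (fun v _ => mul_nonneg (hx0 v) (hy v).le) ?_
      by_contra! hcon
      have : ∀ v, x v = 0 := fun v => by
        by_contra hne
        exact (hcon v (Finset.mem_univ _)).not_gt
          (mul_pos (lt_of_le_of_ne (hx0 v) (Ne.symm hne)) (hy v))
      simp [this] at hx1
    have h2 : ∑ v, x v * (signlessLapMatrix G *ᵥ y) v ≤ lam * ∑ v, x v * y v := by
      rw [Finset.mul_sum]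
      refine Finset.sum_le_sum fun v _ => ?_
      nlinarith [mul_le_mul_of_nonneg_left (h v) (hx0 v)]
    rw [key x hx] at h2
    exact le_of_mul_le_mul_right h2 hpos
  refine ⟨hle, fun hlam x hx0 hx v hv => ?_⟩
  have heq : signlessRadius G = lam := le_antisymm hle hlam
  have h0 : ∑ v, x v * (lam * y v - (signlessLapMatrix G *ᵥ y) v) = 0 := by
    simp only [mul_sub, Finset.sum_sub_distrib]
    rw [key x hx, heq, Finset.mul_sum, sub_eq_zero]
    exact Finset.sum_congr rfl fun v _ => by ring
  have h1 := (Finset.sum_eq_zero_iff_of_nonneg (fun v _ =>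
    mul_nonneg (hx0 v) (sub_nonneg.2 (h v)))).1 h0 v (Finset.mem_univ _)
  rcases mul_eq_zero.1 h1 with h2 | h2
  · exact absurd h2 hv.ne'
  · linarith

theorem signlessRadius_le_two_mul_card [Nonempty V] :
    signlessRadius G ≤ 2 * Fintype.card V := by
  refine (signlessRadius_le_of_mulVec_le G (y := fun _ => 1) (fun _ => one_pos) fun v => ?_).1
  rw [signlessLapMatrix_mulVec]
  calc _ ≤ ∑ _w : V, (2 : ℝ) := Finset.sum_le_sum fun w _ => by split_ifs <;> norm_num
    _ = _ := by simp [mul_comm]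

theorem four_mul_card_edgeFinset_le [Nonempty V] :
    4 * (G.edgeFinset.card : ℝ) ≤ signlessRadius G * Fintype.card V := by
  have h := sum_sq_le_signlessRadius G (fun _ => 1)
  have h2 : ∑ v, ∑ w, (if G.Adj v w then ((1 : ℝ) + 1) ^ 2 else 0) = 4 * ∑ v, (G.degree v : ℝ) := by
    rw [Finset.mul_sum]
    refine Finset.sum_congr rfl fun v _ => ?_
    rw [← Finset.sum_filter, Finset.sum_const, nsmul_eq_mul, ← neighborFinset_eq_filter,
      card_neighborFinset_eq_degree]
    ring
  have h3 : ∑ v, (G.degree v : ℝ) = 2 * G.edgeFinset.card := by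
    exact_mod_cast G.sum_degrees_eq_twice_card_edges
  rw [h2, h3] at h
  simp at h
  linarith

end Spectral

/-! ### Secular equation of complete multipartite graphs and bounds for `k`-colourable graphs -/

section Coloring

variable {V : Type*} [Fintype V] [DecidableEq V] (G : SimpleGraph V) [DecidableRel G.Adj]

/-- The size of a colour class. -/
def classCard {k : ℕ} (C : V → Fin k) (j : Fin k) : ℕ := (Finset.univ.filter fun v => C v = j).card

theorem sum_comp_coloring {k : ℕ} (C : V → Fin k) (f : Fin k → ℝ) :
    ∑ v, f (C v) = ∑ j, classCard C j * f j := by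
  rw [← Finset.sum_fiberwise (s := Finset.univ) (g := C)]
  refine Finset.sum_congr rfl fun j _ => ?_
  rw [Finset.sum_congr rfl (g := fun _ => f j) fun v hv => by rw [(Finset.mem_filter.1 hv).2]]
  simp [classCard]

theorem sum_classCard {k : ℕ} (C : V → Fin k) : ∑ j, (classCard C j : ℝ) = Fintype.card V := by
  have := sum_comp_coloring C (fun _ => 1)
  simpa using this.symm

theorem sum_ne_color {k : ℕ} (C : V → Fin k) (f : Fin k → ℝ) (v : V) :
    (∑ w, if C v ≠ C w then f (C v) + f (C w) else 0) =
      (Fintype.card V - 2 * classCard C (C v)) * f (C v) + ∑ j, classCard C j * f j := by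
  have h := sum_comp_coloring C (fun j => if C v ≠ j then f (C v) + f j else 0)
  rw [h]
  have h2 : ∀ j, (classCard C j : ℝ) * (if C v ≠ j then f (C v) + f j else 0) =
      classCard C j * f (C v) + classCard C j * f j -
        if C v = j then classCard C j * (f (C v) + f j) else 0 := by
    intro j
    by_cases hj : C v = j <;> simp [hj] <;> ring
  simp only [h2, Finset.sum_sub_distrib, Finset.sum_add_distrib, ← Finset.sum_mul, sum_classCard,
    Finset.sum_ite_eq, Finset.mem_univ, if_true]
  ring

/-- The test vector for a complete multipartite graph with the given colour classes. -/
noncomputable def multipartiteVec {k : ℕ} (C : V → Fin k) (a : ℝ) (v : V) : ℝ :=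
  1 / (a + 2 * classCard C (C v))

/-- The secular function of a complete multipartite graph. -/
noncomputable def secular {k : ℕ} (C : V → Fin k) (a : ℝ) : ℝ :=
  ∑ j, (classCard C j : ℝ) / (a + 2 * classCard C j)

theorem multipartiteVec_pos {k : ℕ} (C : V → Fin k) {a : ℝ} (ha : 0 < a) (v : V) :
    0 < multipartiteVec C a v := by
  unfold multipartiteVec; positivity

/-- An eigenvector with eigenvalue `n + a`, constant on the classes, must satisfy `(a + 2c_j) y_j =
Σ c_i y_i`. This dictates the test vector, and it is an eigenvector exactly when the secular
function equals `1`; the defect `secular C a - 1` is the same at every vertex. -/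
theorem sum_multipartiteVec {k : ℕ} (C : V → Fin k) {a : ℝ} (ha : 0 < a) (v : V) :
    (∑ w, if C v ≠ C w then multipartiteVec C a v + multipartiteVec C a w else 0) =
      (Fintype.card V + a) * multipartiteVec C a v + (secular C a - 1) := by
  have h := sum_ne_color C (fun j => 1 / (a + 2 * (classCard C j : ℝ))) v
  unfold multipartiteVec secular
  rw [h]
  have hp : 0 < a + 2 * (classCard C (C v) : ℝ) := by positivity
  simp only [mul_one_div]
  field_simp
  ring

theorem mulVec_multipartiteVec_le {k : ℕ} {C : V → Fin k} (hC : ∀ v w, G.Adj v w → C v ≠ C w)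
    {a : ℝ} (ha : 0 < a) (v : V) :
    (signlessLapMatrix G *ᵥ multipartiteVec C a) v ≤
      (Fintype.card V + a) * multipartiteVec C a v + (secular C a - 1) := by
  rw [← sum_multipartiteVec C ha, signlessLapMatrix_mulVec]
  refine Finset.sum_le_sum fun w _ => ?_
  have := multipartiteVec_pos C ha v
  have := multipartiteVec_pos C ha w
  by_cases h : G.Adj v w
  · simp [h, hC v w h]
  · rw [if_neg h]; split_ifs <;> linarith

theorem adj_of_mulVec_multipartiteVec_eq {k : ℕ} {C : V → Fin k}
    (hC : ∀ v w, G.Adj v w → C v ≠ C w) {a : ℝ} (ha : 0 < a) {v : V}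
    (h : (Fintype.card V + a) * multipartiteVec C a v + (secular C a - 1) ≤
      (signlessLapMatrix G *ᵥ multipartiteVec C a) v) (w : V) (hw : C v ≠ C w) : G.Adj v w := by
  by_contra hvw
  rw [← sum_multipartiteVec C ha, signlessLapMatrix_mulVec] at h
  refine h.not_gt (Finset.sum_lt_sum (fun w _ => ?_) ⟨w, Finset.mem_univ _, ?_⟩)
  · have := multipartiteVec_pos C ha v
    have := multipartiteVec_pos C ha w
    by_cases h : G.Adj v w
    · simp [h, hC v w h]
    · rw [if_neg h]; split_ifs <;> linarith
  · rw [if_neg hvw, if_pos hw]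
    exact add_pos (multipartiteVec_pos C ha v) (multipartiteVec_pos C ha w)

theorem signlessRadius_le_of_secular_le_one [Nonempty V] {k : ℕ} {C : V → Fin k}
    (hC : ∀ v w, G.Adj v w → C v ≠ C w) {a : ℝ} (ha : 0 < a) (h : secular C a ≤ 1) :
    signlessRadius G ≤ Fintype.card V + a := by
  refine (signlessRadius_le_of_mulVec_le G (multipartiteVec_pos C ha) fun v => ?_).1
  linarith [mulVec_multipartiteVec_le G hC ha v]

theorem eq_completeMultipartite_of_le_signlessRadius [Nonempty V] {k : ℕ} {C : V → Fin k}
    (hC : ∀ v w, G.Adj v w → C v ≠ C w) {a : ℝ} (ha : 0 < a) (h : secular C a ≤ 1)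
    (hq : Fintype.card V + a ≤ signlessRadius G) :
    secular C a = 1 ∧ ∀ v w, C v ≠ C w → G.Adj v w := by
  have hle : ∀ v, (signlessLapMatrix G *ᵥ multipartiteVec C a) v ≤
      (Fintype.card V + a) * multipartiteVec C a v := fun v => by
    linarith [mulVec_multipartiteVec_le G hC ha v]
  obtain ⟨x, hx0, hx1, hx⟩ := exists_nonneg_eigenvector G
  have hsupp := (signlessRadius_le_of_mulVec_le G (multipartiteVec_pos C ha) hle).2 hq x hx0 hx
  obtain ⟨v₀, hv₀⟩ : ∃ v, 0 < x v := by
    by_contra! hcon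
    have : ∀ v, x v = 0 := fun v => le_antisymm (hcon v) (hx0 v)
    simp [this] at hx1
  have hsec : secular C a = 1 := by
    have h1 := hsupp v₀ hv₀
    have h2 := mulVec_multipartiteVec_le G hC ha v₀
    linarith
  have hjoin : ∀ v, 0 < x v → ∀ w, C v ≠ C w → G.Adj v w := fun v hv w hw =>
    adj_of_mulVec_multipartiteVec_eq G hC ha (by rw [hsupp v hv, hsec]; linarith) w hw
  -- The support contains everything outside the class of `v₀`: such a vertex is adjacent to `v₀`,
  -- so its eigenvalue equation prevents a zero entry. Two vertices of different colours cannot both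
  -- lie in the class of `v₀`.
  have hpos : ∀ w, C v₀ ≠ C w → 0 < x w := by
    intro w hw
    have hadj := hjoin v₀ hv₀ w hw
    have h1 := congrFun hx w
    rw [signlessLapMatrix_mulVec, Pi.smul_apply, smul_eq_mul] at h1
    have h2 : x w + x v₀ ≤ ∑ u, if G.Adj w u then x w + x u else 0 := by
      have := Finset.single_le_sum (f := fun u => if G.Adj w u then x w + x u else 0)
        (fun u _ => by split_ifs <;> linarith [hx0 w, hx0 u]) (Finset.mem_univ v₀)
      simpa [hadj.symm] using this
    refine lt_of_le_of_ne (hx0 w) fun h0 => ?_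
    rw [h1, ← h0] at h2
    linarith
  refine ⟨hsec, fun v w hvw => ?_⟩
  by_cases hv : C v₀ = C v
  · exact (hjoin w (hpos w (hv ▸ hvw)) v hvw.symm).symm
  · exact hjoin v (hpos v hv) w hvw

/-- Quantitative concavity of `x ↦ x / (a + 2x)`: the gap between the tangent at `c` and the graph.
-/
theorem div_add_two_mul_tangent {a c x : ℝ} (hc : 0 < a + 2 * c) (hx : 0 < a + 2 * x) :
    c / (a + 2 * c) + a / (a + 2 * c) ^ 2 * (x - c) - x / (a + 2 * x) =
      2 * a * (x - c) ^ 2 / ((a + 2 * c) ^ 2 * (a + 2 * x)) := by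
  obtain ⟨m, hm⟩ : ∃ m, m = a + 2 * c := ⟨_, rfl⟩
  obtain ⟨d, hd⟩ : ∃ d, d = a + 2 * x := ⟨_, rfl⟩
  rw [← hm] at hc ⊢
  rw [← hd] at hx ⊢
  obtain rfl : c = (m - a) / 2 := by linarith
  obtain rfl : x = (d - a) / 2 := by linarith
  field_simp
  ring

/-- A `k`-colourable graph on `m` vertices satisfies `q ≤ 2 (1 - 1 / k) m`. -/
theorem signlessRadius_le_of_coloring [Nonempty V] {k : ℕ} (hk : 3 ≤ k) {C : V → Fin k}
    (hC : ∀ v w, G.Adj v w → C v ≠ C w) :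
    signlessRadius G ≤ 2 * (1 - 1 / (k : ℝ)) * Fintype.card V := by
  have hk' : (3 : ℝ) ≤ k := by exact_mod_cast hk
  have hm : (0 : ℝ) < Fintype.card V := by exact_mod_cast Fintype.card_pos
  set m : ℝ := (Fintype.card V : ℝ) with hmdef
  -- With this `a`, equal classes of size `m / k` would give secular value exactly `1`, and `m + a`
  -- is the claimed bound. Summing tangents at `m / k` cancels the linear terms.
  set a : ℝ := (1 - 2 / (k : ℝ)) * m with hadef
  have ha : 0 < a := by
    have : 2 / (k : ℝ) < 1 := by rw [div_lt_one] <;> linarith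
    exact mul_pos (by linarith) hm
  have hma : m = a + 2 * (m / k) := by rw [hadef]; ring
  have hsec : secular C a ≤ 1 := by
    have hterm : ∀ j, (classCard C j : ℝ) / (a + 2 * classCard C j) ≤
        1 / k + a / m ^ 2 * (classCard C j - m / k) := by
      intro j
      set x : ℝ := (classCard C j : ℝ) with hx
      have hx0 : 0 ≤ x := Nat.cast_nonneg _
      have hden : 0 < a + 2 * x := by positivity
      set c : ℝ := m / k with hc
      have h1k : 1 / (k : ℝ) = c / m := by rw [hc]; field_simp
      have : 1 / (k : ℝ) + a / m ^ 2 * (x - c) - x / (a + 2 * x) =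
          2 * a * (x - c) ^ 2 / (m ^ 2 * (a + 2 * x)) := by
        rw [h1k, hma]
        exact div_add_two_mul_tangent (hma ▸ hm) hden
      have h2 : 0 ≤ 2 * a * (x - c) ^ 2 / (m ^ 2 * (a + 2 * x)) := by positivity
      linarith
    calc secular C a ≤ ∑ j : Fin k, (1 / k + a / m ^ 2 * (classCard C j - m / k)) :=
          Finset.sum_le_sum fun j _ => hterm j
      _ = 1 := by
          rw [Finset.sum_add_distrib, ← Finset.mul_sum, Finset.sum_sub_distrib, sum_classCard]
          simp only [Finset.sum_const, Finset.card_univ, Fintype.card_fin, nsmul_eq_mul]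
          rw [← hmdef]
          field_simp
          ring
  have := signlessRadius_le_of_secular_le_one G hC ha hsec
  calc _ ≤ m + a := this
    _ = _ := by rw [hadef]; ring

/-- The value of the secular function at a balanced colouring. -/
noncomputable def balancedSecular (k n : ℕ) (a : ℝ) : ℝ :=
  k * ((n / k : ℕ) / (a + 2 * (n / k : ℕ))) + (n - k * (n / k : ℕ)) *
    (((n / k : ℕ) + 1) / (a + 2 * ((n / k : ℕ) + 1)) - (n / k : ℕ) / (a + 2 * (n / k : ℕ)))

/-- Discrete counterpart of the tangent bound: the chord through `p` and `p + 1` lies above the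
concave function at every integer, with equality only at these two. This singles out balanced
colourings. -/
theorem div_add_two_mul_secant {a : ℝ} (ha : 0 < a) (p x : ℕ) :
    (p : ℝ) / (a + 2 * p) + (x - p) * ((p + 1) / (a + 2 * (p + 1)) - p / (a + 2 * p)) -
      x / (a + 2 * x) =
    2 * a * ((x - p) * (x - p - 1)) / ((a + 2 * p) * (a + 2 * (p + 1)) * (a + 2 * x)) := by
  have h1 : 0 < a + 2 * (p : ℝ) := by positivity
  have h2 : 0 < a + 2 * ((p : ℝ) + 1) := by positivity
  have h3 : 0 < a + 2 * (x : ℝ) := by positivity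
  field_simp
  ring

theorem cast_sub_mul_sub_one_nonneg (p x : ℕ) : (0 : ℝ) ≤ (x - p) * (x - p - 1) := by
  rcases le_or_gt x p with h | h
  · have : (x : ℝ) ≤ p := by exact_mod_cast h
    nlinarith
  · have : (p : ℝ) + 1 ≤ x := by exact_mod_cast h
    nlinarith

theorem sum_secant {k : ℕ} (C : V → Fin k) (a : ℝ) :
    ∑ j, (((Fintype.card V / k : ℕ) : ℝ) / (a + 2 * (Fintype.card V / k : ℕ)) +
      (classCard C j - (Fintype.card V / k : ℕ)) *
      (((Fintype.card V / k : ℕ) + 1) / (a + 2 * ((Fintype.card V / k : ℕ) + 1)) -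
        (Fintype.card V / k : ℕ) / (a + 2 * (Fintype.card V / k : ℕ)))) =
    balancedSecular k (Fintype.card V) a := by
  rw [Finset.sum_add_distrib, ← Finset.sum_mul, Finset.sum_sub_distrib, sum_classCard]
  simp [balancedSecular]

theorem secular_le_balancedSecular {k : ℕ} (C : V → Fin k) {a : ℝ} (ha : 0 < a) :
    secular C a ≤ balancedSecular k (Fintype.card V) a := by
  rw [← sum_secant C a]
  refine Finset.sum_le_sum fun j _ => ?_
  have h := div_add_two_mul_secant ha (Fintype.card V / k) (classCard C j)
  have h2 := cast_sub_mul_sub_one_nonneg (Fintype.card V / k) (classCard C j)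
  rw [← sub_nonneg, h]
  positivity

theorem secular_eq_balancedSecular_iff {k : ℕ} (C : V → Fin k) {a : ℝ} (ha : 0 < a) :
    secular C a = balancedSecular k (Fintype.card V) a ↔
      ∀ j, classCard C j = Fintype.card V / k ∨ classCard C j = Fintype.card V / k + 1 := by
  rw [← sum_secant C a, secular, Finset.sum_eq_sum_iff_of_le]
  · simp only [Finset.mem_univ, true_imp_iff]
    refine forall_congr' fun j => ?_
    rw [eq_comm, ← sub_eq_zero, div_add_two_mul_secant ha]
    set p := Fintype.card V / k
    set x := classCard C j
    have h : (a + 2 * (p : ℝ)) * (a + 2 * (p + 1)) * (a + 2 * (x : ℝ)) ≠ 0 := by positivity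
    rw [div_eq_zero_iff, or_iff_left h, mul_eq_zero, or_iff_right (by positivity), mul_eq_zero,
      sub_eq_zero, sub_sub, sub_eq_zero]
    norm_cast
  · intro j _
    have h := div_add_two_mul_secant ha (Fintype.card V / k) (classCard C j)
    have h2 := cast_sub_mul_sub_one_nonneg (Fintype.card V / k) (classCard C j)
    rw [← sub_nonneg, h]
    positivity

theorem exists_balancedSecular_eq_one {k n : ℕ} (hk : 3 ≤ k) (hn : 3 * k ≤ n) :
    ∃ a : ℝ, 0 < a ∧ balancedSecular k n a = 1 := by
  set p := n / k with hp
  have hkp : k * p ≤ n := Nat.mul_div_le n k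
  have hp3 : 3 ≤ p := (Nat.le_div_iff_mul_le (by omega)).2 hn
  have hkR : (3 : ℝ) ≤ k := by exact_mod_cast hk
  have hpR : (3 : ℝ) ≤ p := by exact_mod_cast hp3
  have hkpR : (k : ℝ) * p ≤ n := by exact_mod_cast hkp
  have hnR : (n : ℝ) ≤ k * p + k := by
    have : n < k * p + k := by
      have := Nat.lt_mul_div_succ n (show 0 < k by omega)
      rw [← hp] at this; linarith
    exact_mod_cast this.le
  have hn9 : (9 : ℝ) ≤ n := by nlinarith
  have hcont : ContinuousOn (balancedSecular k n) (Set.Icc 1 n) := by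
    unfold balancedSecular
    rw [← hp]
    have h1 : ∀ a ∈ Set.Icc (1 : ℝ) n, a + 2 * (p : ℝ) ≠ 0 := fun a ha => by
      have := ha.1; positivity
    have h2 : ∀ a ∈ Set.Icc (1 : ℝ) n, a + 2 * ((p : ℝ) + 1) ≠ 0 := fun a ha => by
      have := ha.1; positivity
    fun_prop (disch := assumption)
  -- At `a = 1` each class has size at least `3` and contributes at least `3/7`, and `3 · 3/7 > 1`.
  -- At `a = n` a class of size `c` contributes at most `c / n`, for a total of at most `1`.
  have hleft : 1 ≤ balancedSecular k n 1 := by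
    unfold balancedSecular
    rw [← hp]
    have h1 : (3 : ℝ) / 7 ≤ p / (1 + 2 * p) := by
      rw [div_le_div_iff₀ (by norm_num) (by positivity)]; linarith
    have h2 : (p : ℝ) / (1 + 2 * p) ≤ (p + 1) / (1 + 2 * (p + 1)) := by
      rw [div_le_div_iff₀ (by positivity) (by positivity)]; nlinarith
    have h3 : 0 ≤ ((n : ℝ) - k * p) * ((p + 1) / (1 + 2 * (p + 1)) - p / (1 + 2 * p)) :=
      mul_nonneg (by linarith) (by linarith)
    nlinarith
  have hright : balancedSecular k n n ≤ 1 := by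
    unfold balancedSecular
    rw [← hp]
    have hn0 : (0 : ℝ) < n := by linarith
    have h1 : (p : ℝ) / (n + 2 * p) ≤ p / n := by gcongr; linarith
    have h2 : ((p : ℝ) + 1) / (n + 2 * (p + 1)) ≤ (p + 1) / n := by gcongr; linarith
    calc _ = ((k : ℝ) * p + k - n) * (p / (n + 2 * p)) +
          (n - k * p) * ((p + 1) / (n + 2 * (p + 1))) := by ring
      _ ≤ ((k : ℝ) * p + k - n) * (p / n) + (n - k * p) * ((p + 1) / n) := by
          gcongr
      _ = 1 := by field_simp; ring
  obtain ⟨a, ha, ha1⟩ := intermediate_value_Icc' (by linarith) hcont ⟨hright, hleft⟩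
  exact ⟨a, by linarith [ha.1], ha1⟩

theorem two_mul_card_edgeFinset_of_coloring {k : ℕ} {C : V → Fin k}
    (hC : ∀ v w, G.Adj v w ↔ C v ≠ C w) :
    2 * (G.edgeFinset.card : ℝ) = (Fintype.card V : ℝ) ^ 2 - ∑ j, (classCard C j : ℝ) ^ 2 := by
  have h1 : 2 * (G.edgeFinset.card : ℝ) = ∑ v, (G.degree v : ℝ) := by
    exact_mod_cast G.sum_degrees_eq_twice_card_edges.symm
  have h2 : ∀ v, (G.degree v : ℝ) = Fintype.card V - classCard C (C v) := by
    intro v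
    rw [eq_sub_iff_add_eq, ← card_neighborFinset_eq_degree, neighborFinset_eq_filter, classCard]
    norm_cast
    rw [← Finset.card_univ, ← Finset.card_filter_add_card_filter_not (s := Finset.univ)
      (p := fun w => G.Adj v w)]
    congr 2
    ext w
    simp [hC, eq_comm]
  rw [h1, Finset.sum_congr rfl fun v _ => h2 v]
  have h3 := sum_comp_coloring C (fun j => (Fintype.card V : ℝ) - classCard C j)
  rw [h3]
  simp only [mul_sub, Finset.sum_sub_distrib, ← Finset.sum_mul, sum_classCard]
  simp [sq]

theorem sum_sq_classCard_ge {k : ℕ} (C : V → Fin k) (p : ℕ) :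
    (2 * p + 1) * (Fintype.card V : ℝ) - k * (p * (p + 1)) ≤ ∑ j, (classCard C j : ℝ) ^ 2 := by
  calc _ = ∑ j, ((2 * p + 1) * (classCard C j : ℝ) - p * (p + 1)) := by
        rw [Finset.sum_sub_distrib, ← Finset.mul_sum, sum_classCard]; simp
    _ ≤ _ := Finset.sum_le_sum fun j _ => by
        nlinarith [cast_sub_mul_sub_one_nonneg p (classCard C j)]

theorem sum_sq_classCard_eq {k : ℕ} (C : V → Fin k) (p : ℕ)
    (h : ∀ j, classCard C j = p ∨ classCard C j = p + 1) :
    ∑ j, (classCard C j : ℝ) ^ 2 = (2 * p + 1) * (Fintype.card V : ℝ) - k * (p * (p + 1)) := by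
  calc _ = ∑ j, ((2 * p + 1) * (classCard C j : ℝ) - p * (p + 1)) :=
        Finset.sum_congr rfl fun j _ => by rcases h j with h | h <;> rw [h] <;> push_cast <;> ring
    _ = _ := by rw [Finset.sum_sub_distrib, ← Finset.mul_sum, sum_classCard]; simp

end Coloring

/-! ### Spectral radius of the Turán graph and its extremality among `k`-colourable graphs -/

section Turan

/-- The colouring of the Turán graph by residues. -/
def residueColoring (n : ℕ) {k : ℕ} (hk : 0 < k) (v : Fin n) : Fin k := ⟨v % k, Nat.mod_lt _ hk⟩

theorem turanGraph_adj_iff (n : ℕ) {k : ℕ} (hk : 0 < k) (v w : Fin n) :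
    (turanGraph n k).Adj v w ↔ residueColoring n hk v ≠ residueColoring n hk w := by
  rw [turanGraph_adj, Ne, Ne, Fin.ext_iff]
  rfl

theorem classCard_residueColoring (n : ℕ) {k : ℕ} (hk : 0 < k) (j : Fin k) :
    classCard (residueColoring n hk) j = n / k ∨ classCard (residueColoring n hk) j = n / k + 1 := by
  have h1 : classCard (residueColoring n hk) j = n.count (· ≡ j [MOD k]) := by
    rw [classCard, Nat.count_eq_card_filter_range]
    refine Finset.card_bij (fun v _ => (v : ℕ)) (fun v hv => ?_) (fun v _ w _ h => Fin.ext h)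
      fun m hm => ?_
    · have := congrArg Fin.val (Finset.mem_filter.1 hv).2
      simpa [Nat.ModEq, Nat.mod_eq_of_lt j.2, residueColoring] using this
    · obtain ⟨h1, h2⟩ := Finset.mem_filter.1 hm
      refine ⟨⟨m, Finset.mem_range.1 h1⟩, ?_, rfl⟩
      rw [Nat.ModEq, Nat.mod_eq_of_lt j.2] at h2
      exact Finset.mem_filter.2 ⟨Finset.mem_univ _, Fin.ext h2⟩
  rw [h1, Nat.count_modEq_card n hk]
  split_ifs <;> simp

/-- The residue classes are balanced, so `multipartiteVec` is an eigenvector with eigenvalue `n +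
a`. -/
theorem le_signlessRadius_turanGraph {n k : ℕ} [NeZero n] (hk : 0 < k) {a : ℝ} (ha : 0 < a)
    (h : balancedSecular k n a = 1) : n + a ≤ signlessRadius (turanGraph n k) := by
  set C := residueColoring n hk
  have hsec : secular C a = 1 := by
    rw [(secular_eq_balancedSecular_iff C ha).2, Fintype.card_fin, h]
    simpa using classCard_residueColoring n hk
  refine le_signlessRadius_of_eigenvector _ (x := multipartiteVec C a) (fun h0 => ?_) ?_
  · exact (multipartiteVec_pos C ha 0).ne' (congrFun h0 0)
  · ext v
    have := sum_multipartiteVec C ha v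
    rw [hsec, sub_self, add_zero, Fintype.card_fin] at this
    rw [signlessLapMatrix_mulVec, Pi.smul_apply, smul_eq_mul, ← this]
    simp only [turanGraph_adj_iff n hk]
    rfl

theorem signlessRadius_turanGraph_ge {n k : ℕ} [NeZero n] (hk : 0 < k) :
    2 * (1 - 1 / (k : ℝ)) * n - k / n ≤ signlessRadius (turanGraph n k) := by
  have h1 := four_mul_card_edgeFinset_le (turanGraph n k)
  have h2 := two_mul_card_edgeFinset_of_coloring (turanGraph n k) (turanGraph_adj_iff n hk)
  rw [sum_sq_classCard_eq _ (n / k) (classCard_residueColoring n hk)] at h2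
  rw [Fintype.card_fin] at h1 h2
  set p : ℝ := ((n / k : ℕ) : ℝ)
  have hn : (0 : ℝ) < n := by exact_mod_cast Nat.pos_of_neZero n
  have hkR : (0 : ℝ) < k := by exact_mod_cast hk
  have h3 : (2 * (1 - 1 / (k : ℝ)) * n - k / n) * n ≤
      2 * ((n : ℝ) ^ 2 - ((2 * p + 1) * n - k * (p * (p + 1)))) := by
    have h4 : 0 ≤ 2 * ((n : ℝ) - k * (p + 1 / 2)) ^ 2 / k := by positivity
    -- Completing the square in `n - k(p + 1/2)` shows that four times the number of Turán edges is
    -- at least `2(1 - 1/k)n² - k`.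
    have h5 : 2 * ((n : ℝ) ^ 2 - ((2 * p + 1) * n - k * (p * (p + 1)))) -
        (2 * (1 - 1 / (k : ℝ)) * n - k / n) * n =
        2 * ((n : ℝ) - k * (p + 1 / 2)) ^ 2 / k + k / 2 := by
      field_simp
      ring
    linarith
  refine le_of_mul_le_mul_right (h3.trans ?_) hn
  linarith

/-- Among `k`-colourable graphs the Turán graph is the unique maximizer of `q`. -/
theorem nonempty_iso_turanGraph_of_coloring {V : Type*} [Fintype V] [DecidableEq V]
    (G : SimpleGraph V) [DecidableRel G.Adj] {k : ℕ} (hk : 3 ≤ k) (hn : 3 * k ≤ Fintype.card V)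
    {C : V → Fin k} (hC : ∀ v w, G.Adj v w → C v ≠ C w)
    (hq : signlessRadius (turanGraph (Fintype.card V) k) ≤ signlessRadius G) :
    Nonempty (G ≃g turanGraph (Fintype.card V) k) := by
  have hk0 : 0 < k := by omega
  have : Nonempty V := Fintype.card_pos_iff.1 (by omega)
  have : NeZero (Fintype.card V) := ⟨by omega⟩
  obtain ⟨a, ha, ha1⟩ := exists_balancedSecular_eq_one hk hn
  have hlam := (le_signlessRadius_turanGraph hk0 ha ha1).trans hq
  have hle := (secular_le_balancedSecular C ha).trans ha1.le
  obtain ⟨hsec, hjoin⟩ := eq_completeMultipartite_of_le_signlessRadius G hC ha hle hlam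
  have hcard := (secular_eq_balancedSecular_iff C ha).1 (hsec.trans ha1.symm)
  have hiff : ∀ v w, G.Adj v w ↔ C v ≠ C w := fun v w => ⟨hC v w, hjoin v w⟩
  have hcol : G.Colorable k := ⟨Coloring.mk C fun {v w} h => hC v w h⟩
  have hcf : G.CliqueFree (k + 1) := hcol.cliqueFree (Nat.lt_succ_self k)
  -- Now `G` is complete multipartite and balanced, hence has at least as many edges as the Turán
  -- graph; the isomorphism comes from uniqueness in the edge version of Turán's theorem.
  rw [← isTuranMaximal_iff_nonempty_iso_turanGraph hk0]
  refine ⟨hcf, fun H _ hH => ?_⟩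
  have h1 := two_mul_card_edgeFinset_of_coloring G hiff
  rw [sum_sq_classCard_eq C _ hcard] at h1
  have h2 := two_mul_card_edgeFinset_of_coloring (turanGraph (Fintype.card V) k)
    (turanGraph_adj_iff _ hk0)
  have h3 := sum_sq_classCard_ge (residueColoring (Fintype.card V) hk0) (Fintype.card V / k)
  rw [Fintype.card_fin] at h2 h3
  have h4 := hH.card_edgeFinset_le
  simp only at h4
  rw [← card_edgeFinset_turanGraph] at h4
  have h5 : ((turanGraph (Fintype.card V) k).edgeFinset.card : ℝ) ≤ G.edgeFinset.card := by
    linarith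
  have h6 : (turanGraph (Fintype.card V) k).edgeFinset.card ≤ G.edgeFinset.card := by
    exact_mod_cast h5
  exact h4.trans h6

end Turan

/-! ### Vertex deletion and passage to a dense induced subgraph of large minimum degree -/

section Deletion

variable {V : Type*} [Fintype V] [DecidableEq V] (G : SimpleGraph V) [DecidableRel G.Adj]

/-- The signless Laplacian spectral radius of the subgraph induced on `S`. -/
noncomputable def radiusOn (S : Finset V) : ℝ := signlessRadius (G.induce (S : Set V))

/-- The number of neighbours of `v` in `S`. -/
def degOn (S : Finset V) (v : V) : ℕ := (S.filter (G.Adj v)).card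

theorem sum_coe_set (S : Finset V) (f : V → ℝ) : ∑ v : (S : Set V), f v = ∑ v ∈ S, f v := by
  rw [Finset.sum_set_coe, Finset.toFinset_coe]

theorem sum_sq_le_radiusOn {S : Finset V} (hS : S.Nonempty) (x : V → ℝ) :
    (∑ v ∈ S, ∑ w ∈ S, if G.Adj v w then (x v + x w) ^ 2 else 0) ≤
      2 * radiusOn G S * ∑ v ∈ S, x v ^ 2 := by
  have : Nonempty (S : Set V) := hS.coe_sort
  have h : (∑ v : (S : Set V), ∑ w : (S : Set V), if G.Adj v w then (x v + x w) ^ 2 else 0) ≤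
      2 * radiusOn G S * ∑ v : (S : Set V), x v ^ 2 :=
    sum_sq_le_signlessRadius (G.induce (S : Set V)) (fun v => x v)
  rw [sum_coe_set S (fun v => x v ^ 2), Finset.sum_congr rfl fun (v : (S : Set V)) _ =>
    sum_coe_set S (fun w => if G.Adj v w then (x v + x w) ^ 2 else 0), sum_coe_set S
    (fun v => ∑ w ∈ S, if G.Adj v w then (x v + x w) ^ 2 else 0)] at h
  exact h

theorem exists_nonneg_eigenvector_on {S : Finset V} (hS : S.Nonempty) :
    ∃ x : V → ℝ, (∀ v, 0 ≤ x v) ∧ ∑ v ∈ S, x v ^ 2 = 1 ∧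
      ∀ v ∈ S, radiusOn G S * x v = ∑ w ∈ S, if G.Adj v w then x v + x w else 0 := by
  have : Nonempty (S : Set V) := hS.coe_sort
  obtain ⟨y, hy0, hy1, hy⟩ := exists_nonneg_eigenvector (G.induce (S : Set V))
  set x : V → ℝ := fun v => if h : v ∈ S then y ⟨v, h⟩ else 0 with hx
  have hxy : ∀ v : (S : Set V), x v = y v := fun v => by
    have : (v : V) ∈ S := v.2
    simp [hx, this]
  refine ⟨x, fun v => ?_, ?_, fun v hv => ?_⟩
  · simp only [hx]; split_ifs
    · exact hy0 _
    · exact le_rfl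
  · rw [← sum_coe_set S (fun v => x v ^ 2), ← hy1]
    exact Finset.sum_congr rfl fun v _ => by rw [hxy]
  · have h := congrFun hy ⟨v, hv⟩
    rw [signlessLapMatrix_mulVec, Pi.smul_apply, smul_eq_mul] at h
    rw [radiusOn, ← sum_coe_set S (fun w => if G.Adj v w then x v + x w else 0), hxy ⟨v, hv⟩, ← h]
    refine Finset.sum_congr rfl fun w _ => ?_
    rw [hxy]; rfl

theorem signlessRadius_le_radiusOn_univ [Nonempty V] :
    signlessRadius G ≤ radiusOn G Finset.univ := by
  obtain ⟨x, -, hx1, hx⟩ := exists_nonneg_eigenvector G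
  have h1 := sum_sq_le_radiusOn G Finset.univ_nonempty x
  rw [← two_mul_dotProduct_signlessLapMatrix, hx, dotProduct_smul, smul_eq_mul, hx1] at h1
  have h2 : x ⬝ᵥ x = 1 := by rw [← hx1]; simp [dotProduct, sq]
  rw [h2] at h1
  linarith

theorem radiusOn_le {S : Finset V} (hS : S.Nonempty) : radiusOn G S ≤ 2 * S.card := by
  have : Nonempty (S : Set V) := hS.coe_sort
  simpa [radiusOn] using signlessRadius_le_two_mul_card (G.induce (S : Set V))

theorem sum_ite_adj (S : Finset V) (v : V) (c : ℝ) :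
    (∑ w ∈ S, if G.Adj v w then c else 0) = degOn G S v * c := by
  rw [← Finset.sum_filter, Finset.sum_const, nsmul_eq_mul, degOn]

/-- The double sum runs over ordered pairs, so each edge at `u` is lost twice. -/
theorem sum_sq_erase (S : Finset V) {u : V} (hu : u ∈ S) (x : V → ℝ) :
    (∑ v ∈ S, ∑ w ∈ S, if G.Adj v w then (x v + x w) ^ 2 else 0) =
      (∑ v ∈ S.erase u, ∑ w ∈ S.erase u, if G.Adj v w then (x v + x w) ^ 2 else 0) +
        2 * ∑ w ∈ S, if G.Adj u w then (x u + x w) ^ 2 else 0 := by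
  rw [← Finset.add_sum_erase S _ hu]
  have h1 : ∀ v, (∑ w ∈ S, if G.Adj v w then (x v + x w) ^ 2 else 0) =
      (if G.Adj v u then (x v + x u) ^ 2 else 0) +
        ∑ w ∈ S.erase u, if G.Adj v w then (x v + x w) ^ 2 else 0 := fun v =>
    (Finset.add_sum_erase S _ hu).symm
  have h2 : ∑ v ∈ S.erase u, (if G.Adj v u then (x v + x u) ^ 2 else 0) =
      ∑ w ∈ S, if G.Adj u w then (x u + x w) ^ 2 else 0 := by
    rw [← Finset.add_sum_erase S _ hu]
    simp only [SimpleGraph.irrefl, if_false, zero_add]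
    exact Finset.sum_congr rfl fun w _ => by simp only [G.adj_comm w u, add_comm]
  rw [Finset.sum_congr rfl (s₁ := S.erase u) fun v _ => h1 v, Finset.sum_add_distrib, h2]
  ring

theorem sum_sq_neighbors_le (S : Finset V) {x : V → ℝ} (h1 : ∑ v ∈ S, x v ^ 2 = 1) {c : ℝ}
    (hc : ∀ v ∈ S, c ≤ x v ^ 2) (v : V) :
    (∑ w ∈ S, if G.Adj v w then x w ^ 2 else 0) ≤ 1 - (S.card - degOn G S v) * c := by
  have h2 : (∑ w ∈ S, if G.Adj v w then x w ^ 2 else 0) +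
      (∑ w ∈ S, if G.Adj v w then 0 else x w ^ 2) = 1 := by
    rw [← Finset.sum_add_distrib, ← h1]
    exact Finset.sum_congr rfl fun w _ => by split_ifs <;> simp
  have h3 : (S.card - degOn G S v) * c ≤ ∑ w ∈ S, if G.Adj v w then 0 else x w ^ 2 := by
    have : (S.card - degOn G S v) * c = ∑ w ∈ S, (c - if G.Adj v w then c else 0) := by
      rw [Finset.sum_sub_distrib, sum_ite_adj]; simp; ring
    rw [this]
    refine Finset.sum_le_sum fun w hw => ?_
    split_ifs
    · simp
    · simpa using hc w hw
  linarith

/-- Deleting the vertex with the smallest eigenvector entry. -/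
theorem exists_delete_vertex {S : Finset V} (hS : 2 ≤ S.card) :
    ∃ u ∈ S, ∃ ξ : ℝ, 0 ≤ ξ ∧ S.card * ξ ≤ 1 ∧
      radiusOn G S - 1 - (2 * radiusOn G S - S.card) * ξ ≤ radiusOn G (S.erase u) * (1 - ξ) ∧
      ∀ w ∈ S, (radiusOn G S - degOn G S w) ^ 2 * ξ ≤
        degOn G S w * (1 - (S.card - degOn G S w) * ξ) := by
  have hSn : S.Nonempty := Finset.card_pos.1 (by omega)
  obtain ⟨x, hx0, hx1, hx⟩ := exists_nonneg_eigenvector_on G hSn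
  obtain ⟨u, hu, hmin⟩ := S.exists_min_image x hSn
  set q := radiusOn G S with hqdef
  have hmin2 : ∀ v ∈ S, x u ^ 2 ≤ x v ^ 2 := fun v hv =>
    pow_le_pow_left₀ (hx0 u) (hmin v hv) 2
  have hsplit : ∀ v ∈ S, (∑ w ∈ S, if G.Adj v w then x w else 0) = (q - degOn G S v) * x v := by
    intro v hv
    have h1 := hx v hv
    have h2 : (∑ w ∈ S, if G.Adj v w then x v + x w else 0) =
        (∑ w ∈ S, if G.Adj v w then x v else 0) + ∑ w ∈ S, if G.Adj v w then x w else 0 := by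
      rw [← Finset.sum_add_distrib]
      exact Finset.sum_congr rfl fun w _ => by split_ifs <;> simp
    rw [h2, sum_ite_adj] at h1
    linarith
  -- Here `ξ` is the smallest squared entry. The deletion bound tests `G[S \ {u}]` with the
  -- restriction of `x`, and the unknown degree of `u` cancels. The degree bound is Cauchy–Schwarz
  -- in the eigenvalue equation at `w`, with `x w ^ 2 ≥ ξ`.
  refine ⟨u, hu, x u ^ 2, sq_nonneg _, ?_, ?_, ?_⟩
  · rw [← hx1, ← nsmul_eq_mul]
    exact Finset.card_nsmul_le_sum _ _ _ hmin2
  · have hen : (S.erase u).Nonempty := by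
      rw [← Finset.card_pos, Finset.card_erase_of_mem hu]; omega
    have h1 := sum_sq_le_radiusOn G hen x
    have h2 := sum_sq_erase G S hu x
    have h3 : (∑ v ∈ S, ∑ w ∈ S, if G.Adj v w then (x v + x w) ^ 2 else 0) = 2 * q := by
      have e1 : (∑ v ∈ S, ∑ w ∈ S, if G.Adj v w then x v * (x v + x w) else 0) = q := by
        calc _ = ∑ v ∈ S, q * x v ^ 2 := Finset.sum_congr rfl fun v hv => by
              rw [sq, ← mul_assoc, hx v hv, mul_comm, Finset.mul_sum]
              simp only [mul_ite, mul_zero]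
          _ = q := by rw [← Finset.mul_sum, hx1, mul_one]
      have e2 : (∑ v ∈ S, ∑ w ∈ S, if G.Adj v w then x w * (x v + x w) else 0) = q := by
        rw [← e1, Finset.sum_comm]
        refine Finset.sum_congr rfl fun v _ => Finset.sum_congr rfl fun w _ => ?_
        simp only [G.adj_comm w v, add_comm]
      rw [two_mul]
      nth_rewrite 1 [← e1]
      rw [← e2, ← Finset.sum_add_distrib]
      refine Finset.sum_congr rfl fun v _ => ?_
      rw [← Finset.sum_add_distrib]
      refine Finset.sum_congr rfl fun w _ => ?_
      split_ifs <;> ring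
    have h4 : (∑ w ∈ S, if G.Adj u w then (x u + x w) ^ 2 else 0) =
        (2 * q - degOn G S u) * x u ^ 2 + ∑ w ∈ S, if G.Adj u w then x w ^ 2 else 0 := by
      have e : ∀ w, (if G.Adj u w then (x u + x w) ^ 2 else 0) =
          (if G.Adj u w then x u ^ 2 else 0) + 2 * x u * (if G.Adj u w then x w else 0) +
            if G.Adj u w then x w ^ 2 else 0 := fun w => by split_ifs <;> ring
      rw [Finset.sum_congr rfl fun w _ => e w, Finset.sum_add_distrib, Finset.sum_add_distrib,
        ← Finset.mul_sum, hsplit u hu, sum_ite_adj]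
      ring
    have h5 := sum_sq_neighbors_le G S hx1 hmin2 u
    have h6 : ∑ v ∈ S.erase u, x v ^ 2 = 1 - x u ^ 2 := by
      rw [← hx1, ← Finset.add_sum_erase S _ hu]; ring
    rw [h6] at h1
    rw [h3, h4] at h2
    nlinarith
  · intro w hw
    have h1 := sum_sq_neighbors_le G S hx1 hmin2 w
    have hd : (degOn G S w : ℝ) ≤ S.card := by exact_mod_cast Finset.card_filter_le _ _
    have hd0 : (0 : ℝ) ≤ degOn G S w := Nat.cast_nonneg _
    have hcs : ((q - degOn G S w) * x w) ^ 2 ≤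
        degOn G S w * ∑ z ∈ S, if G.Adj w z then x z ^ 2 else 0 := by
      rw [← hsplit w hw, ← Finset.sum_filter, ← Finset.sum_filter, degOn]
      exact sq_sum_le_card_mul_sum_sq
    calc _ ≤ (q - degOn G S w) ^ 2 * x w ^ 2 := by gcongr; exact hx0 u; exact hmin w hw
      _ = ((q - degOn G S w) * x w) ^ 2 := by ring
      _ ≤ _ := hcs
      _ ≤ _ := by gcongr

/-- After scaling by `m`, the deletion bound forces `μ = mξ` to be close to its maximum `1`, i.e.
the eigenvector is almost constant. For `μ = 1` the Cauchy–Schwarz bound reads `θ² ≤ 2θd`, giving `d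
≥ θ/2`. -/
theorem half_density_le_of_delete {m q r d ξ κ : ℝ} (hm : 0 < m) (hκ : 0 ≤ κ)
    (hq : 5 / 4 * m ≤ q) (hq2 : q ≤ 2 * m) (hd : 0 ≤ d) (hξ0 : 0 ≤ ξ) (hξ1 : m * ξ ≤ 1)
    (hm1 : 1 ≤ m) (h1 : q - 1 - (2 * q - m) * ξ ≤ r * (1 - ξ)) (h2 : r ≤ q - q / m + κ)
    (h3 : (q - d) ^ 2 * ξ ≤ d * (1 - (m - d) * ξ)) :
    (q / m / 2 - 4 * (κ + 2 / m)) * m ≤ d := by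
  obtain ⟨θ, rfl⟩ : ∃ θ, q = θ * m := ⟨q / m, by field_simp⟩
  obtain ⟨μ, rfl⟩ : ∃ μ, ξ = μ / m := ⟨m * ξ, by field_simp⟩
  obtain ⟨d, rfl⟩ : ∃ δ, d = δ * m := ⟨d / m, by field_simp⟩
  have hθ1 : 5 / 4 ≤ θ := le_of_mul_le_mul_right hq hm
  have hθ2 : θ ≤ 2 := le_of_mul_le_mul_right hq2 hm
  have hd0 : 0 ≤ d := nonneg_of_mul_nonneg_left hd hm
  rw [mul_div_cancel₀ _ hm.ne'] at hξ1
  rw [mul_div_cancel_right₀ _ hm.ne'] at h2 ⊢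
  have hμ0 : 0 ≤ μ := by
    have : μ = μ / m * m := by field_simp
    rw [this]; positivity
  have hξm : μ / m ≤ 1 / m := by gcongr
  have hξle : μ / m ≤ 1 := hξm.trans (by rw [div_le_one hm]; exact hm1)
  have h5 : (1 - μ / m) * (θ - κ) ≤ 1 + (θ - 1) * μ := by
    have h := h1.trans (mul_le_mul_of_nonneg_right h2 (sub_nonneg.2 hξle))
    have e : θ * m - 1 - (2 * (θ * m) - m) * (μ / m) = θ * m - 1 - 2 * θ * μ + μ := by
      field_simp; ring
    have e' : (θ * m - θ + κ) * (1 - μ / m) = θ * m - θ * μ - (1 - μ / m) * (θ - κ) := by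
      field_simp; ring
    rw [e, e'] at h
    linarith
  -- The factor `4` is the inverse of the lower bound `1/4` for `θ - 1`; this is the purpose of the
  -- constant `5/4`.
  have h6 : 1 - 4 * (κ + 2 / m) ≤ μ := by
    have e1 : θ * (μ / m) ≤ 2 / m := by
      calc θ * (μ / m) ≤ 2 * (1 / m) := by gcongr
        _ = 2 / m := by ring
    have e2 : θ - 1 - (κ + 2 / m) ≤ (θ - 1) * μ := by
      have : 0 ≤ κ * (μ / m) := mul_nonneg hκ hξ0
      linarith
    have e3 : 0 ≤ κ + 2 / m := by positivity
    have e4 : (θ - 1) * (1 - μ) ≤ κ + 2 / m := by linarith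
    have e5 : 1 / 4 * (1 - μ) ≤ (θ - 1) * (1 - μ) :=
      mul_le_mul_of_nonneg_right (by linarith) (by linarith)
    linarith
  have h7 : (θ - d) ^ 2 * μ ≤ d * (1 - (1 - d) * μ) := by
    have e : (θ * m - d * m) ^ 2 * (μ / m) = (θ - d) ^ 2 * μ * m := by field_simp
    have e' : d * m * (1 - (m - d * m) * (μ / m)) = d * (1 - (1 - d) * μ) * m := by field_simp
    rw [e, e'] at h3
    exact le_of_mul_le_mul_right h3 hm
  have h8 : θ / 2 - (1 - μ) ≤ d := by
    -- The terms `d²μ` on the two sides cancel, leaving a bound linear in `d`.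
    have e : θ ^ 2 * μ ≤ d * (2 * θ * μ + 1 - μ) := by linarith
    have hden : 1 ≤ 2 * θ * μ + 1 - μ := by nlinarith
    have e3 : (θ / 2 - (1 - μ)) * (2 * θ * μ + 1 - μ) ≤ θ ^ 2 * μ := by
      have e4 : (1 - μ) * 1 ≤ (1 - μ) * (2 * θ * μ + 1 - μ) :=
        mul_le_mul_of_nonneg_left hden (by linarith)
      have e5 : θ * (1 - μ) ≤ 2 * (1 - μ) := mul_le_mul_of_nonneg_right hθ2 (by linarith)
      linarith
    exact le_of_mul_le_mul_right (e3.trans e) (by linarith)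
  gcongr
  linarith

/-- The local estimate: if deleting no vertex lowers `q(G[S])` by less than
`q(G[S]) / |S| - κ`, then the minimum degree of `G[S]` is almost `q(G[S]) / 2`. -/
theorem degOn_ge_of_erase_le {S : Finset V} (hS : 2 ≤ S.card) {κ : ℝ} (hκ : 0 ≤ κ)
    (hq : 5 / 4 * (S.card : ℝ) ≤ radiusOn G S)
    (h : ∀ u ∈ S, radiusOn G (S.erase u) ≤ radiusOn G S - radiusOn G S / S.card + κ) :
    ∀ w ∈ S, (radiusOn G S / S.card / 2 - 4 * (κ + 2 / S.card)) * S.card ≤ degOn G S w := by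
  have hm2 : (2 : ℝ) ≤ S.card := by exact_mod_cast hS
  obtain ⟨u, hu, ξ, hξ0, hξ1, h1, h2⟩ := exists_delete_vertex G hS
  exact fun w hw => half_density_le_of_delete (by linarith) hκ hq
    (radiusOn_le G (Finset.card_pos.1 (by omega))) (Nat.cast_nonneg _) hξ0 hξ1 (by linarith) h1
    (h u hu) (h2 w hw)

/-- Maximizing `q(G[S]) / |S| + κ log |S|` gives a large set `S` whose induced subgraph has at
least the same density and almost the largest possible minimum degree. -/
theorem exists_dense_induced [Nonempty V] {κ : ℝ} (hκ : 0 < κ)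
    (hq : 5 / 4 * (Fintype.card V : ℝ) ≤ signlessRadius G)
    (hcard : Real.exp (2 / κ) < Fintype.card V) :
    ∃ S : Finset V, 2 ≤ S.card ∧ Real.log (Fintype.card V) - 2 / κ ≤ Real.log S.card ∧
      signlessRadius G / Fintype.card V + κ * (Real.log (Fintype.card V) - Real.log S.card) ≤
        radiusOn G S / S.card ∧
      ∀ w ∈ S, (radiusOn G S / S.card / 2 - 4 * (κ + 2 / S.card)) * S.card ≤ degOn G S w := by
  set ψ : Finset V → ℝ := fun S => radiusOn G S / S.card + κ * Real.log S.card with hψ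
  have hn : (0 : ℝ) < Fintype.card V := by exact_mod_cast Fintype.card_pos
  obtain ⟨S, hS, hmax⟩ := ((Finset.univ : Finset (Finset V)).filter (·.Nonempty)).exists_max_image
    ψ ⟨Finset.univ, by simp [Finset.univ_nonempty]⟩
  have hSn : S.Nonempty := (Finset.mem_filter.1 hS).2
  have hmax' : ∀ T : Finset V, T.Nonempty → ψ T ≤ ψ S := fun T hT => hmax T (by simp [hT])
  have hcpos : (0 : ℝ) < S.card := by exact_mod_cast hSn.card_pos
  have huniv := hmax' Finset.univ Finset.univ_nonempty
  simp only [hψ, Finset.card_univ] at huniv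
  have hθV : signlessRadius G / Fintype.card V ≤ radiusOn G Finset.univ / Fintype.card V := by
    gcongr; exact signlessRadius_le_radiusOn_univ G
  have hlogle : Real.log S.card ≤ Real.log (Fintype.card V) :=
    Real.log_le_log hcpos (by exact_mod_cast S.card_le_univ)
  have hθ2 : radiusOn G S / S.card ≤ 2 := by
    rw [div_le_iff₀ hcpos]; exact radiusOn_le G hSn
  have h1 : signlessRadius G / Fintype.card V + κ * (Real.log (Fintype.card V) - Real.log S.card) ≤
      radiusOn G S / S.card := by linarith
  have h54 : 5 / 4 ≤ signlessRadius G / Fintype.card V := by rwa [le_div_iff₀ hn]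
  have hlog : Real.log (Fintype.card V) - 2 / κ ≤ Real.log S.card := by
    have : Real.log (Fintype.card V) - Real.log S.card ≤ 2 / κ := by
      rw [le_div_iff₀ hκ]; linarith
    linarith
  have hc2 : 2 ≤ S.card := by
    have e1 : 2 / κ < Real.log (Fintype.card V) := (Real.lt_log_iff_exp_lt hn).2 hcard
    have e2 : 0 < Real.log S.card := by linarith
    have e3 : (1 : ℝ) < S.card := (Real.log_pos_iff hcpos.le).1 e2
    exact_mod_cast e3
  refine ⟨S, hc2, hlog, h1, degOn_ge_of_erase_le G hc2 hκ.le ?_ fun u hu => ?_⟩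
  · rw [← le_div_iff₀ hcpos]
    nlinarith
  · have hce : ((S.erase u).card : ℝ) = S.card - 1 := by
      rw [Finset.card_erase_of_mem hu, Nat.cast_sub (by omega), Nat.cast_one]
    have hm2 : (2 : ℝ) ≤ S.card := by exact_mod_cast hc2
    have hm1 : (0 : ℝ) < S.card - 1 := by linarith
    have h2 := hmax' (S.erase u) (by
      rw [← Finset.card_pos, Finset.card_erase_of_mem hu]; omega)
    simp only [hψ, hce] at h2
    -- After multiplication by `|S| - 1`, the change in `κ log |S|` costs at most `κ`, as the local
    -- estimate requires.
    have h3 : Real.log S.card - Real.log (S.card - 1) ≤ 1 / (S.card - 1) := by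
      rw [← Real.log_div hcpos.ne' hm1.ne']
      refine (Real.log_le_sub_one_of_pos (by positivity)).trans (le_of_eq ?_)
      field_simp
      ring
    have h4 : radiusOn G (S.erase u) / (S.card - 1) ≤
        radiusOn G S / S.card + κ * (1 / (S.card - 1)) := by nlinarith
    rw [div_le_iff₀ hm1] at h4
    refine h4.trans (le_of_eq ?_)
    field_simp

end Deletion

/-! ### Building `K_k^+[t]` from a clique, or colouring in its absence -/

section Joints

variable {V : Type*} [Fintype V] [DecidableEq V] (G : SimpleGraph V) [DecidableRel G.Adj]

/-- The tuples `p i` are the transversals of a complete multipartite graph. -/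
def Joined {r t : ℕ} (p : Fin t → Fin r → V) : Prop :=
  (∀ a, Function.Injective fun i => p i a) ∧ ∀ i j a b, a ≠ b → G.Adj (p i a) (p j b)

/-- If each of `t` joined tuples has many common neighbours in `Y`, a positive proportion of them
can be extended to joined tuples by vertices of `Y`. -/
theorem Joined.exists_extend {r t t' : ℕ} {p : Fin t → Fin r → V} (hp : Joined G p)
    (Y : Finset V) {β : ℝ} (hβ : 0 < β)
    (hY : ∀ i, β * Fintype.card V ≤ ((Y.filter fun y => ∀ a, G.Adj y (p i a)).card : ℝ))
    (ht : (t' : ℝ) ≤ β / 2 * t) (hn : (2 : ℝ) ^ t * t' < β / 2 * Fintype.card V) :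
    ∃ (σ : Fin t' → Fin t) (y : Fin t' → V), (∀ i, y i ∈ Y) ∧
      Joined G fun i => (Fin.cons (y i) (p (σ i)) : Fin (r + 1) → V) := by
  classical
  rcases Nat.eq_zero_or_pos t' with rfl | ht'
  · exact ⟨Fin.elim0, Fin.elim0, fun i => i.elim0, fun a i => i.elim0, fun i => i.elim0⟩
  have htpos : (0 : ℝ) < t := by
    have : (0 : ℝ) < t' := by exact_mod_cast ht'
    by_contra! h
    nlinarith
  set N : V → Finset (Fin t) := fun y => Finset.univ.filter fun i => ∀ a, G.Adj y (p i a) with hN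
  -- Double counting gives at least `β/2 · |V|` vertices that see at least `β/2 · t` of the tuples.
  -- Pigeonholing over the `2^t` possible sets `N y` then yields more than `t'` of them with the
  -- same set.
  set good : Finset V := Y.filter fun y => β / 2 * t ≤ (N y).card with hgood
  have hsum : (t : ℝ) * (β * Fintype.card V) ≤ ∑ y ∈ Y, ((N y).card : ℝ) := by
    have h1 : ∑ y ∈ Y, ((N y).card : ℝ) =
        ∑ i : Fin t, ((Y.filter fun y => ∀ a, G.Adj y (p i a)).card : ℝ) := by
      simp only [hN, Finset.card_filter, Nat.cast_sum]
      exact Finset.sum_comm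
    rw [h1]
    calc _ = ∑ _i : Fin t, β * (Fintype.card V : ℝ) := by simp
      _ ≤ _ := Finset.sum_le_sum fun i _ => hY i
  have hub : ∑ y ∈ Y, ((N y).card : ℝ) ≤ good.card * t + Fintype.card V * (β / 2 * t) := by
    rw [← Finset.sum_filter_add_sum_filter_not Y fun y => β / 2 * t ≤ ((N y).card : ℝ)]
    refine add_le_add ?_ ?_
    · rw [← nsmul_eq_mul]
      refine Finset.sum_le_card_nsmul _ _ _ fun y _ => ?_
      have := (N y).card_le_univ
      rw [Fintype.card_fin] at this
      exact_mod_cast this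
    · refine (Finset.sum_le_card_nsmul _ _ (β / 2 * t) fun y hy =>
        (not_le.1 (Finset.mem_filter.1 hy).2).le).trans ?_
      rw [nsmul_eq_mul]
      gcongr
      exact Finset.card_le_univ _
  have hgc : β / 2 * Fintype.card V ≤ good.card := by
    refine le_of_mul_le_mul_right ?_ htpos
    linarith
  obtain ⟨T, -, hT⟩ := Finset.exists_lt_card_fiber_of_mul_lt_card_of_maps_to
    (s := good) (t := (Finset.univ : Finset (Finset (Fin t)))) (f := N) (n := t')
    (fun _ _ => Finset.mem_univ _) (by
      rw [Finset.card_univ, Fintype.card_finset, Fintype.card_fin]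
      exact_mod_cast hn.trans_le hgc)
  have hTcard : t' ≤ T.card := by
    obtain ⟨y, hy⟩ := Finset.card_pos.1 (Nat.zero_lt_of_lt hT)
    obtain ⟨hy1, rfl⟩ := Finset.mem_filter.1 hy
    exact_mod_cast ht.trans (Finset.mem_filter.1 hy1).2
  obtain ⟨σ⟩ : Nonempty (Fin t' ↪ T) := Function.Embedding.nonempty_of_card_le (by simpa)
  obtain ⟨y⟩ : Nonempty (Fin t' ↪ (good.filter fun y => N y = T)) :=
    Function.Embedding.nonempty_of_card_le (by rw [Fintype.card_fin, Fintype.card_coe]; exact hT.le)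
  have hyN : ∀ i, N (y i) = T := fun i => (Finset.mem_filter.1 (y i).2).2
  have hyY : ∀ i, (y i : V) ∈ Y := fun i =>
    (Finset.mem_filter.1 (Finset.mem_filter.1 (y i).2).1).1
  have hadj : ∀ i j a, G.Adj (y i) (p (σ j) a) := by
    intro i j a
    have h : (σ j : Fin t) ∈ N (y i) := by rw [hyN]; exact (σ j).2
    exact (Finset.mem_filter.1 h).2 a
  refine ⟨fun i => σ i, fun i => y i, hyY, fun a => ?_, fun i j a b hab => ?_⟩
  · refine Fin.cases ?_ (fun a => ?_) a
    · intro i j hij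
      exact y.injective (Subtype.ext (by simpa using hij))
    · intro i j hij
      exact σ.injective (Subtype.ext (hp.1 a (by simpa using hij)))
  · revert hab
    refine Fin.cases ?_ (fun a => ?_) a <;> refine Fin.cases ?_ (fun b => ?_) b
    · exact fun h => absurd rfl h
    · exact fun _ => by simpa using hadj i j b
    · exact fun _ => by simpa using (hadj j i a).symm
    · exact fun h => by simpa using hp.2 (σ i) (σ j) a b fun h' => h (by rw [h'])

theorem two_pow_mul_le_four_pow {t K : ℕ} (hK : 0 < K) :
    (2 : ℝ) ^ (K * t) * t ≤ 4 ^ (K * t) := by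
  have h1 : (t : ℝ) ≤ 2 ^ (K * t) := by
    have h2 : t ≤ 2 ^ (K * t) :=
      (Nat.le_mul_of_pos_left t hK).trans (Nat.lt_two_pow_self).le
    exact_mod_cast h2
  calc (2 : ℝ) ^ (K * t) * t ≤ 2 ^ (K * t) * 2 ^ (K * t) := by gcongr
    _ = 4 ^ (K * t) := by rw [← mul_pow]; norm_num

/-- Each new part shrinks the number of tuples by a factor `K ≥ 2/β`, so `r` parts of size `t` are
obtained by starting from `K^r * t` empty tuples. -/
theorem exists_joined_of_common_neighbors {W : Finset V} {β : ℝ} (hβ : 0 < β) {K : ℕ}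
    (hK : 2 ≤ β * K) {R : ℕ}
    (hW : ∀ r < R, ∀ q : Fin r → V, (∀ a, q a ∈ W) →
      β * Fintype.card V ≤ ((W.filter fun y => ∀ a, G.Adj y (q a)).card : ℝ)) :
    ∀ r ≤ R, ∀ t : ℕ, (4 : ℝ) ^ (K ^ r * t) < β / 2 * Fintype.card V →
      ∃ p : Fin t → Fin r → V, Joined G p ∧ ∀ i a, p i a ∈ W := by
  have hK0 : 0 < K := by
    rcases Nat.eq_zero_or_pos K with rfl | h
    · norm_num at hK
    · exact h
  intro r
  induction r with
  | zero => exact fun _ t _ => ⟨fun _ => Fin.elim0, ⟨fun a => a.elim0, fun _ _ a => a.elim0⟩,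
      fun _ a => a.elim0⟩
  | succ r ih =>
    intro hr t ht
    obtain ⟨p, hp, hpW⟩ := ih (by omega) (K * t) (by rwa [← mul_assoc, ← pow_succ])
    have hle : (4 : ℝ) ^ (K * t) ≤ 4 ^ (K ^ (r + 1) * t) := by
      refine pow_le_pow_right₀ (by norm_num) (Nat.mul_le_mul_right _ ?_)
      exact Nat.le_self_pow (by omega) K
    obtain ⟨σ, y, hy, hj⟩ := hp.exists_extend G (t' := t) W hβ
      (fun i => hW r (by omega) _ (hpW i)) (by push_cast; nlinarith [Nat.cast_nonneg (α := ℝ) t])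
      ((two_pow_mul_le_four_pow hK0).trans_lt (hle.trans_lt ht))
    refine ⟨_, hj, fun i a => ?_⟩
    refine Fin.cases ?_ (fun a => ?_) a
    · simpa using hy i
    · simpa using hpW (σ i) a

/-- Union bound over non-neighbours, each vertex counting as its own non-neighbour. -/
theorem card_common_neighbors_ge {D : ℝ} (hD : ∀ v, (Fintype.card V : ℝ) - G.degree v ≤ D)
    (Y : Finset V) {r : ℕ} (q : Fin r → V) :
    (Y.card : ℝ) - r * D ≤ ((Y.filter fun y => ∀ a, G.Adj y (q a)).card : ℝ) := by
  have h1 : Y ⊆ (Y.filter fun y => ∀ a, G.Adj y (q a)) ∪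
      Finset.univ.biUnion fun a => Finset.univ.filter fun y => ¬ G.Adj y (q a) := by
    intro y hy
    by_cases h : ∀ a, G.Adj y (q a)
    · exact Finset.mem_union_left _ (Finset.mem_filter.2 ⟨hy, h⟩)
    · push Not at h
      obtain ⟨a, ha⟩ := h
      exact Finset.mem_union_right _ (Finset.mem_biUnion.2 ⟨a, Finset.mem_univ _, by simpa⟩)
  have h2 := (Finset.card_le_card h1).trans (Finset.card_union_le _ _)
  have h3 : ∀ v, ((Finset.univ.filter fun y => ¬ G.Adj y v).card : ℝ) ≤ D := by
    intro v
    refine le_trans (le_of_eq ?_) (hD v)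
    rw [eq_sub_iff_add_eq, ← card_neighborFinset_eq_degree, neighborFinset_eq_filter]
    norm_cast
    rw [add_comm, ← Finset.card_univ,
      ← Finset.card_filter_add_card_filter_not (s := Finset.univ) (p := fun w => G.Adj v w)]
    simp only [G.adj_comm v]
  have h4 : ((Finset.univ.biUnion fun a : Fin r =>
      Finset.univ.filter fun y => ¬ G.Adj y (q a)).card : ℝ) ≤ r * D := by
    calc _ ≤ ((∑ a : Fin r, (Finset.univ.filter fun y => ¬ G.Adj y (q a)).card : ℕ) : ℝ) := by
          exact_mod_cast Finset.card_biUnion_le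
      _ = ∑ a : Fin r, ((Finset.univ.filter fun y => ¬ G.Adj y (q a)).card : ℝ) := by push_cast; rfl
      _ ≤ ∑ _a : Fin r, D := Finset.sum_le_sum fun a _ => h3 _
      _ = r * D := by simp
  have h5 : (Y.card : ℝ) ≤ (Y.filter fun y => ∀ a, G.Adj y (q a)).card +
      (Finset.univ.biUnion fun a : Fin r => Finset.univ.filter fun y => ¬ G.Adj y (q a)).card := by
    exact_mod_cast h2
  linarith

/-- Some pair in a set of `k + 1` vertices of large degree has large codegree. -/
theorem exists_pair_codegree_gt {k : ℕ} {R : Finset V} (hR : R.card = k + 1) (hk : 1 ≤ k)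
    {δ c : ℝ} (hdeg : ∀ v ∈ R, δ ≤ G.degree v)
    (h : (k + 1) * k * c + k * (k - 1) * Fintype.card V < (2 * k - 2) * ((k + 1) * δ)) :
    ∃ u ∈ R, ∃ v ∈ R, u ≠ v ∧
      c < ((Finset.univ.filter fun x => G.Adj x u ∧ G.Adj x v).card : ℝ) := by
  by_contra! hcon
  have hkR : (1 : ℝ) ≤ k := by exact_mod_cast hk
  set d : V → ℝ := fun x => ∑ a ∈ R, if G.Adj x a then 1 else 0 with hd
  have hdnat : ∀ x, d x = ((R.filter fun a => G.Adj x a).card : ℕ) := fun x => by simp [hd]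
  -- The integer `d x` is never strictly between `k - 1` and `k`. Summing `(d - k)(d - k + 1) ≥ 0`
  -- over `x` bounds the codegrees from below in terms of the degrees.
  have hpt : ∀ x, 0 ≤ d x ^ 2 - (2 * k - 1) * d x + k * (k - 1) := by
    intro x
    have h1 := cast_sub_mul_sub_one_nonneg (k - 1) (R.filter fun a => G.Adj x a).card
    rw [Nat.cast_sub hk, ← hdnat] at h1
    push_cast at h1
    nlinarith
  have hsum0 : 0 ≤ ∑ x, (d x ^ 2 - (2 * k - 1) * d x + k * (k - 1)) :=
    Finset.sum_nonneg fun x _ => hpt x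
  have hdegsum : ∀ a, ∑ x, (if G.Adj x a then (1 : ℝ) else 0) = G.degree a := by
    intro a
    rw [← card_neighborFinset_eq_degree, neighborFinset_eq_filter]
    simp [G.adj_comm a]
  have hsum1 : ∑ x, d x = ∑ a ∈ R, (G.degree a : ℝ) := by
    rw [Finset.sum_comm]
    exact Finset.sum_congr rfl fun a _ => hdegsum a
  have hsum2 : ∑ x, d x ^ 2 ≤ ∑ a ∈ R, (G.degree a : ℝ) + (k + 1) * (k * c) := by
    have e1 : ∑ x, d x ^ 2 = ∑ a ∈ R, ∑ b ∈ R, ∑ x,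
        (if G.Adj x a then (1 : ℝ) else 0) * (if G.Adj x b then 1 else 0) := by
      simp only [hd, sq, Finset.sum_mul_sum]
      rw [Finset.sum_comm]
      exact Finset.sum_congr rfl fun a _ => Finset.sum_comm
    have e2 : ∀ a b, ∑ x, (if G.Adj x a then (1 : ℝ) else 0) * (if G.Adj x b then 1 else 0) =
        ((Finset.univ.filter fun x => G.Adj x a ∧ G.Adj x b).card : ℝ) := by
      intro a b
      rw [Finset.card_filter, Nat.cast_sum]
      refine Finset.sum_congr rfl fun x _ => ?_
      by_cases h1 : G.Adj x a <;> by_cases h2 : G.Adj x b <;> simp [h1, h2]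
    have e3 : ∀ a ∈ R, ∑ b ∈ R, ∑ x,
        (if G.Adj x a then (1 : ℝ) else 0) * (if G.Adj x b then 1 else 0) ≤
        G.degree a + k * c := by
      intro a ha
      rw [← Finset.add_sum_erase R _ ha]
      refine add_le_add (le_of_eq ?_) ?_
      · rw [← hdegsum]
        exact Finset.sum_congr rfl fun x _ => by split_ifs <;> simp
      · refine (Finset.sum_le_card_nsmul _ _ c fun b hb => ?_).trans (le_of_eq ?_)
        · rw [e2]
          exact hcon a ha b (Finset.mem_of_mem_erase hb) (Finset.ne_of_mem_erase hb).symm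
        · rw [Finset.card_erase_of_mem ha, hR, Nat.add_sub_cancel, nsmul_eq_mul]
    rw [e1]
    refine (Finset.sum_le_sum e3).trans (le_of_eq ?_)
    rw [Finset.sum_add_distrib, Finset.sum_const, hR, nsmul_eq_mul]
    push_cast
    ring
  have hdl : (k + 1) * δ ≤ ∑ a ∈ R, (G.degree a : ℝ) := by
    have := Finset.card_nsmul_le_sum R (fun a => (G.degree a : ℝ)) δ hdeg
    rw [hR, nsmul_eq_mul] at this
    exact_mod_cast this
  rw [Finset.sum_add_distrib, Finset.sum_sub_distrib, ← Finset.mul_sum, hsum1] at hsum0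
  simp only [Finset.sum_const, Finset.card_univ, nsmul_eq_mul] at hsum0
  have : (2 * k - 2) * ((k + 1) * δ) ≤ (2 * k - 2) * ∑ a ∈ R, (G.degree a : ℝ) :=
    mul_le_mul_of_nonneg_left hdl (by linarith)
  nlinarith

/-- Adding two vertices to the first part of a joined family gives `K_k^+[t]`. -/
theorem isContained_of_joined {r t : ℕ} {u v : V} (huv : G.Adj u v)
    {p : Fin t → Fin (r + 1) → V} (hp : Joined G p) (hu0 : ∀ i, p i 0 ≠ u) (hv0 : ∀ i, p i 0 ≠ v)
    (hu : ∀ i (a : Fin r), G.Adj u (p i a.succ)) (hv : ∀ i (a : Fin r), G.Adj v (p i a.succ)) :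
    (multipartitePlus (r + 1) t).IsContained G := by
  -- The vertices `u` and `v` replace entries `0` and `1` of part `0`, so that the part keeps size
  -- `t`.
  set f0 : Fin t → V := fun i => if i.val = 0 then u else if i.val = 1 then v else p i 0 with hf0
  have hf0inj : Function.Injective f0 := by
    intro i j hij
    have hne := huv.ne
    by_contra hijne
    have hval : i.val ≠ j.val := fun h => hijne (Fin.ext h)
    have hpij : p i 0 ≠ p j 0 := fun h => hijne (hp.1 0 h)
    simp only [hf0] at hij
    split_ifs at hij <;> first
      | omega
      | exact hne hij
      | exact hne hij.symm
      | exact hu0 _ hij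
      | exact hu0 _ hij.symm
      | exact hv0 _ hij
      | exact hv0 _ hij.symm
      | exact hpij hij
  have hf0adj : ∀ i j (a : Fin r), G.Adj (f0 i) (p j a.succ) := by
    intro i j a
    simp only [hf0]
    split_ifs
    · exact hu j a
    · exact hv j a
    · exact hp.2 i j 0 a.succ (Fin.succ_ne_zero a).symm
  set f : Fin (r + 1) × Fin t → V := fun x => Fin.cases (f0 x.2) (fun a => p x.2 a.succ) x.1 with hf
  have hfadj : ∀ a b i j, a ≠ b → G.Adj (f (a, i)) (f (b, j)) := by
    intro a b i j
    refine Fin.cases ?_ (fun a => ?_) a <;> refine Fin.cases ?_ (fun b => ?_) b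
    · exact fun h => absurd rfl h
    · exact fun _ => hf0adj i j b
    · exact fun _ => (hf0adj j i a).symm
    · exact fun h => hp.2 i j a.succ b.succ h
  have hfinj : Function.Injective f := by
    rintro ⟨a, i⟩ ⟨b, j⟩ hij
    have hab : a = b := by
      by_contra h
      exact (hfadj a b i j h).ne hij
    subst hab
    congr 1
    revert hij
    refine Fin.cases ?_ (fun a => ?_) a
    · exact fun h => hf0inj h
    · exact fun h => hp.1 a.succ h
  refine ⟨⟨⟨f, ?_⟩, hfinj⟩⟩
  rintro ⟨a, i⟩ ⟨b, j⟩ hab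
  rw [multipartitePlus_adj] at hab
  rcases hab with hab | ⟨ha, hb, h⟩
  · exact hfadj a b i j hab
  · obtain rfl : a = 0 := Fin.ext ha
    obtain rfl : b = 0 := Fin.ext hb
    change G.Adj (f0 i) (f0 j)
    simp only at h
    rcases h with ⟨hi, hj⟩ | ⟨hi, hj⟩
    · simpa [hf0, hi, hj] using huv
    · simpa [hf0, hi, hj] using huv.symm

/-- A graph with large minimum degree that contains `K_{k+1}` contains `K_k^+[t]`
for some `t` of logarithmic order. -/
theorem isContained_of_not_cliqueFree {k : ℕ} (hk : 3 ≤ k)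
    (hdeg : ∀ v, (1 - 1 / (k : ℝ) - 1 / (4 * (k : ℝ) ^ 4)) * Fintype.card V ≤ G.degree v)
    (hcf : ¬ G.CliqueFree (k + 1)) {t : ℕ} (hm : 4 * (k : ℝ) ≤ Fintype.card V)
    (ht : (4 : ℝ) ^ ((8 * k ^ 3) ^ k * t) < 1 / (8 * (k : ℝ) ^ 3) * Fintype.card V) :
    (multipartitePlus k t).IsContained G := by
  have hkR : (3 : ℝ) ≤ k := by exact_mod_cast hk
  set m : ℝ := (Fintype.card V : ℝ) with hmdef
  have hmpos : 0 < m := by linarith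
  -- The relative degree error is `β / k`, and `8k³ = 2/β` is the loss factor per part. For exact
  -- degree `(1 - 1/k)m` the codegree count has slack `2/k`, while the errors total at most `6βk² =
  -- 3/(2k)`; this leaves codegree above `(1 - 2/k + 2β)m`.
  obtain ⟨β, hβ⟩ : ∃ β : ℝ, β = 1 / (4 * (k : ℝ) ^ 3) := ⟨_, rfl⟩
  have hβ0 : 0 < β := by rw [hβ]; positivity
  have hε : 1 / (4 * (k : ℝ) ^ 4) = β / k := by rw [hβ]; field_simp
  have hβk : β * k ^ 2 = 1 / (4 * (k : ℝ)) := by rw [hβ]; field_simp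
  obtain ⟨z, hz⟩ : ∃ z : ℝ, z = 1 / (k : ℝ) := ⟨_, rfl⟩
  have hzk : z * k = 1 := by rw [hz]; field_simp
  have hz0 : 0 < z := by rw [hz]; positivity
  have hβz : β * k ^ 2 = z / 4 := by rw [hβk, hz]; field_simp
  have hεz : 1 / (4 * (k : ℝ) ^ 4) = β * z := by rw [hε, hz]; ring
  rw [hεz, ← hz] at hdeg
  have h8 : 1 / (8 * (k : ℝ) ^ 3) = β / 2 := by rw [hβ]; field_simp; norm_num
  rw [h8] at ht
  have hβle : 9 * β ≤ z / 4 := by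
    have h9 : (9 : ℝ) ≤ k ^ 2 := by nlinarith
    rw [← hβz]
    nlinarith
  rw [SimpleGraph.CliqueFree] at hcf
  push Not at hcf
  obtain ⟨R, hR⟩ := hcf
  obtain ⟨u, hu, v, hv, huv, hcod⟩ := exists_pair_codegree_gt G (k := k) (R := R) hR.card_eq
    (by omega) (δ := (1 - z - β * z) * m) (c := (1 - 2 * z + 2 * β) * m) (fun v _ => hdeg v) (by
      rw [← hmdef]
      have : ((k : ℝ) + 1) * k * (1 - 2 * z + 2 * β) + k * (k - 1) <
          (2 * k - 2) * ((k + 1) * (1 - z - β * z)) := by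
        have e1 : ((k : ℝ) + 1) * k * (1 - 2 * z + 2 * β) + k * (k - 1) =
            2 * k ^ 2 - 2 * k - 2 + 2 * (β * k ^ 2) + 2 * β * k := by
          linear_combination (-2 * (k : ℝ) - 2) * hzk
        have e2 : (2 * (k : ℝ) - 2) * ((k + 1) * (1 - z - β * z)) =
            2 * k ^ 2 - 2 - 2 * k + 2 * z - 2 * β * k + 2 * β * z := by
          linear_combination (-2 * (k : ℝ) - 2 * β * k) * hzk
        have e3 : β * k ≤ β * k ^ 2 := by gcongr; nlinarith
        rw [e1, e2]
        nlinarith [mul_pos hβ0 hz0]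
      nlinarith)
  have hadj : G.Adj u v := hR.isClique hu hv huv
  set W : Finset V := Finset.univ.filter fun x => G.Adj x u ∧ G.Adj x v with hW
  have hD : ∀ v, (Fintype.card V : ℝ) - G.degree v ≤ (z + β * z) * m := fun v => by
    have := hdeg v
    rw [← hmdef]
    linarith
  obtain ⟨r, rfl⟩ : ∃ r, k = r + 1 := ⟨k - 1, by omega⟩
  have hr2 : (2 : ℝ) ≤ r := by push_cast at hkR; linarith
  have hrz : (r : ℝ) * z = 1 - z := by push_cast at hzk; linarith
  have hWstep : ∀ s < r, ∀ q : Fin s → V, (∀ a, q a ∈ W) →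
      β * Fintype.card V ≤ ((W.filter fun y => ∀ a, G.Adj y (q a)).card : ℝ) := by
    intro s hs q _
    refine le_trans ?_ (card_common_neighbors_ge G hD W q)
    rw [← hmdef]
    have hs' : (s : ℝ) + 1 ≤ r := by exact_mod_cast hs
    have e1 : (s : ℝ) * ((z + β * z) * m) ≤ (r - 1) * ((z + β * z) * m) := by
      gcongr
      linarith
    have e2 : ((r : ℝ) - 1) * (z + β * z) = (1 - 2 * z) + β * (1 - 2 * z) := by
      linear_combination (1 + β) * hrz
    have e3 : ((r : ℝ) - 1) * ((z + β * z) * m) = ((1 - 2 * z) + β * (1 - 2 * z)) * m := by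
      rw [← mul_assoc, e2]
    have e4 : 0 ≤ β * z * m := by positivity
    rw [e3] at e1
    linarith
  have hK : 2 ≤ β * ((8 * (r + 1) ^ 3 : ℕ) : ℝ) := by
    rw [hβ]
    push_cast
    refine le_of_eq ?_
    field_simp
    norm_num
  have hKpos : 0 < 8 * (r + 1) ^ 3 := by positivity
  -- Inside `W` only `r = k - 1` parts fit: at most `k - 2` earlier vertices exclude about `(1 -
  -- 2/k)m` candidates. The last part is sought outside `W`, where `k - 1` vertices still leave
  -- almost `m / k` common neighbours.
  obtain ⟨p, hp, hpW⟩ := exists_joined_of_common_neighbors G hβ0 hK hWstep r le_rfl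
    (8 * (r + 1) ^ 3 * t) (by rwa [← mul_assoc, ← pow_succ])
  have hYcard : m - 2 ≤ (((Finset.univ : Finset V) \ {u, v}).card : ℝ) := by
    rw [Finset.card_sdiff_of_subset (Finset.subset_univ _), Finset.card_pair huv, Finset.card_univ,
      Nat.cast_sub]
    · simp [hmdef]
    · have : (2 : ℝ) ≤ (Fintype.card V : ℝ) := by rw [← hmdef]; linarith
      exact_mod_cast this
  have hmz : 4 ≤ m * z := by
    have := mul_le_mul_of_nonneg_right hm hz0.le
    linarith
  obtain ⟨σ, y, hy, hj⟩ := hp.exists_extend G (t' := t) (Finset.univ \ {u, v}) hβ0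
    (fun i => by
      refine le_trans ?_ (card_common_neighbors_ge G hD _ (p i))
      rw [← hmdef]
      have e1 : (r : ℝ) * ((z + β * z) * m) = ((1 - z) + β * (1 - z)) * m := by
        rw [← hrz]; ring
      have e2 : β * m * 36 ≤ m * z := by nlinarith
      have e3 : 0 ≤ β * m * z := by positivity
      rw [e1]
      linarith)
    (by push_cast at hK ⊢; nlinarith [Nat.cast_nonneg (α := ℝ) t])
    ((two_pow_mul_le_four_pow hKpos).trans_lt (lt_of_le_of_lt (by
      refine pow_le_pow_right₀ (by norm_num) (Nat.mul_le_mul_right _ ?_)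
      exact Nat.le_self_pow (by omega) _) ht))
  have hyne : ∀ i, y i ≠ u ∧ y i ≠ v := fun i => by simpa using hy i
  refine isContained_of_joined G hadj hj (fun i => (hyne i).1) (fun i => (hyne i).2)
    (fun i a => ?_) fun i a => ?_
  · simpa using ((Finset.mem_filter.1 (hpW (σ i) a)).2.1).symm
  · simpa using ((Finset.mem_filter.1 (hpW (σ i) a)).2.2).symm

/-- A graph with large minimum degree without `K_k^+[t]` is `k`-colourable. -/
theorem colorable_of_degree_ge {k : ℕ} (hk : 3 ≤ k) [Nonempty V]
    (hdeg : ∀ v, (1 - 1 / (k : ℝ) - 1 / (4 * (k : ℝ) ^ 4)) * Fintype.card V ≤ G.degree v)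
    (hcf : G.CliqueFree (k + 1)) : G.Colorable k := by
  -- Andrásfai–Erdős–Sós: minimum degree above `(3k - 4)/(3k - 1)` times the order suffices, and `1
  -- - 1/k - 1/(4k⁴)` exceeds this ratio.
  refine colorable_of_cliqueFree_lt_minDegree hcf ?_
  obtain ⟨v, hv⟩ := G.exists_minimal_degree_vertex
  rw [hv, Nat.div_lt_iff_lt_mul (by omega)]
  have hkR : (3 : ℝ) ≤ k := by exact_mod_cast hk
  have hm : (0 : ℝ) < Fintype.card V := by exact_mod_cast Fintype.card_pos
  have h : ((3 * k - 4 : ℕ) : ℝ) * Fintype.card V < G.degree v * ((3 * k - 1 : ℕ) : ℝ) := by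
    rw [Nat.cast_sub (by omega), Nat.cast_sub (by omega)]
    push_cast
    have h1 := hdeg v
    have h2 : (3 * (k : ℝ) - 4) < (1 - 1 / (k : ℝ) - 1 / (4 * (k : ℝ) ^ 4)) * (3 * k - 1) := by
      have e : (1 - 1 / (k : ℝ) - 1 / (4 * (k : ℝ) ^ 4)) * (3 * k - 1) - (3 * (k : ℝ) - 4) =
          (4 * k ^ 3 - 3 * k + 1) / (4 * k ^ 4) := by
        field_simp
        ring
      have : 0 < (4 * (k : ℝ) ^ 3 - 3 * k + 1) / (4 * k ^ 4) := by
        apply div_pos _ (by positivity)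
        nlinarith [mul_pos (show (0 : ℝ) < k by linarith) (show (0 : ℝ) < k by linarith)]
      linarith
    calc (3 * (k : ℝ) - 4) * Fintype.card V <
          (1 - 1 / (k : ℝ) - 1 / (4 * (k : ℝ) ^ 4)) * (3 * k - 1) * Fintype.card V := by gcongr
      _ = (1 - 1 / (k : ℝ) - 1 / (4 * (k : ℝ) ^ 4)) * Fintype.card V * (3 * k - 1) := by ring
      _ ≤ _ := by gcongr; linarith
  exact_mod_cast h

end Joints

/-! ### Dichotomy for the dense induced subgraph and choice of constants -/

section Main

variable {V : Type*} [Fintype V] [DecidableEq V] (G : SimpleGraph V) [DecidableRel G.Adj]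

theorem degree_induce_eq_degOn (S : Finset V) (v : (S : Set V)) :
    ((G.induce (S : Set V)).degree v : ℝ) = degOn G S v := by
  have h := sum_coe_set S fun w => if G.Adj v w then (1 : ℝ) else 0
  rw [sum_ite_adj, mul_one] at h
  rw [← h, ← card_neighborFinset_eq_degree, neighborFinset_eq_filter]
  simp

theorem four_pow_lt_of_le_log {K t : ℕ} {m b : ℝ} (hm : 0 < m) (hb : 0 < b)
    (hbm : 2 * Real.log b < Real.log m) (ht : 4 * K * (t : ℝ) ≤ Real.log m) :
    (4 : ℝ) ^ (K * t) < 1 / b * m := by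
  have h4 : Real.log 4 ≤ 2 := by
    have h := Real.log_two_lt_d9
    have : Real.log 4 = 2 * Real.log 2 := by
      rw [show (4 : ℝ) = 2 ^ 2 by norm_num, Real.log_pow]; norm_num
    linarith
  rw [← Real.log_lt_log_iff (by positivity) (by positivity), Real.log_pow,
    Real.log_mul (by positivity) hm.ne', one_div, Real.log_inv]
  push_cast
  have : (K : ℝ) * t * Real.log 4 ≤ K * t * 2 := by gcongr
  linarith

/-- The vertex threshold, on a logarithmic scale, above which the main theorem is proved. -/
noncomputable def logThreshold (k : ℕ) : ℝ := 1000 * (k : ℝ) ^ 5 + 17 * ((8 * k ^ 3) ^ k : ℕ)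

theorem isContained_or_nonempty_iso {k : ℕ} (hk : 3 ≤ k)
    (hn : logThreshold k ≤ Real.log (Fintype.card V))
    (hq : signlessRadius (turanGraph (Fintype.card V) k) ≤ signlessRadius G) {t : ℕ}
    (ht : 8 * ((8 * k ^ 3) ^ k : ℕ) * (t : ℝ) ≤ Real.log (Fintype.card V)) :
    (multipartitePlus k t).IsContained G ∨
      Nonempty (G ≃g turanGraph (Fintype.card V) k) := by
  have hkR : (3 : ℝ) ≤ k := by exact_mod_cast hk
  have hk1 : (1 : ℝ) ≤ k := by linarith
  have hk5 : (243 : ℝ) ≤ (k : ℝ) ^ 5 := by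
    calc (243 : ℝ) = 3 ^ 5 := by norm_num
      _ ≤ _ := by gcongr
  have hpow : ∀ i ≤ 5, (k : ℝ) ^ i ≤ (k : ℝ) ^ 5 := fun i hi => pow_le_pow_right₀ hk1 hi
  have hL : 1000 * (k : ℝ) ^ 5 ≤ Real.log (Fintype.card V) := by
    refine le_trans ?_ hn
    unfold logThreshold
    exact le_add_of_nonneg_right (by positivity)
  set n : ℝ := (Fintype.card V : ℝ) with hndef
  have hn0 : 0 < n := by
    rcases Nat.eq_zero_or_pos (Fintype.card V) with h | h
    · rw [hndef, h] at hL
      norm_num at hL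
      linarith
    · rw [hndef]; exact_mod_cast h
  have hVpos : 0 < Fintype.card V := by rw [hndef] at hn0; exact_mod_cast hn0
  have : Nonempty V := Fintype.card_pos_iff.1 hVpos
  have : NeZero (Fintype.card V) := ⟨hVpos.ne'⟩
  have hlogn : Real.log n ≤ n := (Real.log_le_sub_one_of_pos hn0).trans (by linarith)
  have hnL : 1000 * (k : ℝ) ^ 5 ≤ n := hL.trans hlogn
  have hT := (signlessRadius_turanGraph_ge (n := Fintype.card V) (k := k) (by omega)).trans hq
  rw [← hndef] at hT
  -- Chosen so that `16κ = 1/(4k⁴)` is the permitted degree loss: `4(κ + 2/|S|) ≤ 8κ`, and the Turán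
  -- deficit `k/n²` is at most `κ`.
  obtain ⟨κ, hκ⟩ : ∃ κ : ℝ, κ = 1 / (64 * (k : ℝ) ^ 4) := ⟨_, rfl⟩
  have hκ0 : 0 < κ := by rw [hκ]; positivity
  have hκi : 2 / κ = 128 * (k : ℝ) ^ 4 := by rw [hκ]; field_simp; norm_num
  have hkn : (k : ℝ) / n < κ := by
    rw [hκ, div_lt_div_iff₀ hn0 (by positivity)]
    have : (k : ℝ) * (64 * k ^ 4) = 64 * k ^ 5 := by ring
    linarith
  have hκ12 : κ ≤ 1 / 12 := by
    rw [hκ]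
    gcongr
    have : (1 : ℝ) ≤ k ^ 4 := one_le_pow₀ hk1
    linarith
  have h1k : 1 / (k : ℝ) ≤ 1 / 3 := by gcongr
  have hn1 : 1 ≤ n := by linarith
  have hknn : (k : ℝ) / n / n ≤ κ / n := by gcongr
  have hκn : κ / n ≤ κ := div_le_self hκ0.le hn1
  have hθV : 2 * (1 - 1 / (k : ℝ)) - k / n / n ≤ signlessRadius G / n := by
    rw [le_div_iff₀ hn0]
    refine le_trans (le_of_eq ?_) hT
    field_simp
  have h54 : 5 / 4 * n ≤ signlessRadius G := by
    rw [← le_div_iff₀ hn0]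
    linarith
  obtain ⟨S, hS2, hlog, hθ, hdeg⟩ := exists_dense_induced G hκ0 h54 (by
    rw [← Real.lt_log_iff_exp_lt hn0, hκi]
    linarith [hpow 4 (by norm_num)])
  rw [← hndef] at hlog hθ
  have hS0 : (0 : ℝ) < S.card := by exact_mod_cast (by omega : 0 < S.card)
  have hSn : S.Nonempty := Finset.card_pos.1 (by omega)
  have hlogm : Real.log n / 2 ≤ Real.log S.card := by
    rw [hκi] at hlog
    linarith [hpow 4 (by norm_num)]
  have hmlog : Real.log S.card ≤ S.card :=
    (Real.log_le_sub_one_of_pos hS0).trans (by linarith)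
  have hm500 : 500 * (k : ℝ) ^ 5 ≤ S.card := by linarith
  have hSle : (S.card : ℝ) ≤ n := by rw [hndef]; exact_mod_cast S.card_le_univ
  have hlogle : Real.log S.card ≤ Real.log n := Real.log_le_log hS0 hSle
  have hnS : Nonempty (S : Set V) := hSn.coe_sort
  have hcardS : Fintype.card (S : Set V) = S.card := by simp
  have hdegH : ∀ v : (S : Set V), (1 - 1 / (k : ℝ) - 1 / (4 * (k : ℝ) ^ 4)) *
      Fintype.card (S : Set V) ≤ (G.induce (S : Set V)).degree v := by
    intro v
    rw [hcardS, degree_induce_eq_degOn]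
    refine le_trans ?_ (hdeg v v.2)
    have h2m : 2 / (S.card : ℝ) ≤ κ := by
      rw [div_le_iff₀ hS0, ← div_le_iff₀' hκ0, hκi]
      linarith [hpow 4 (by norm_num)]
    have hε : 1 / (4 * (k : ℝ) ^ 4) = 16 * κ := by rw [hκ]; field_simp; norm_num
    have h0 : 0 ≤ κ * (Real.log n - Real.log S.card) := mul_nonneg hκ0.le (by linarith)
    refine mul_le_mul_of_nonneg_right ?_ hS0.le
    rw [hε]
    linarith
  by_cases hcf : (G.induce (S : Set V)).CliqueFree (k + 1)
  · right
    obtain ⟨C⟩ := colorable_of_degree_ge (G.induce (S : Set V)) hk hdegH hcf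
    -- For a proper `S` the maximality gain `κ(log n - log |S|) ≥ κ/n` beats the deficit `k/n²`,
    -- pushing the density of `G[S]` above the bound `2(1 - 1/k)` for `k`-colourable graphs.
    have hSuniv : S = Finset.univ := by
      by_contra hne
      have hlt : S.card < Fintype.card V := Finset.card_lt_univ_of_notMem
        (by simpa [Finset.eq_univ_iff_forall] using hne : ∃ x, x ∉ S).choose_spec
      have hlt' : (S.card : ℝ) + 1 ≤ n := by rw [hndef]; exact_mod_cast hlt
      have h1 : radiusOn G S ≤ 2 * (1 - 1 / (k : ℝ)) * S.card := by
        have h := signlessRadius_le_of_coloring (G.induce (S : Set V)) hk (C := C)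
          fun v w h => C.valid h
        rwa [hcardS] at h
      rw [← div_le_iff₀ hS0] at h1
      have h2 : 1 / n ≤ Real.log n - Real.log S.card := by
        have h := Real.log_le_sub_one_of_pos (div_pos hS0 hn0)
        rw [Real.log_div hS0.ne' hn0.ne'] at h
        have h' : (S.card : ℝ) / n ≤ 1 - 1 / n := by
          rw [div_le_iff₀ hn0]
          field_simp
          linarith
        linarith
      have h3 : κ / n ≤ κ * (Real.log n - Real.log S.card) := by
        calc κ / n = κ * (1 / n) := by ring
          _ ≤ _ := by gcongr
      have h4 : (k : ℝ) / n / n < κ / n := by gcongr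
      linarith
    subst hSuniv
    have hcard3 : 3 * k ≤ Fintype.card V := by
      have : 3 * (k : ℝ) ≤ n := by linarith [hpow 1 (by norm_num), pow_one (k : ℝ)]
      rw [hndef] at this
      exact_mod_cast this
    exact nonempty_iso_turanGraph_of_coloring G hk hcard3 (C := fun v => C ⟨v, by simp⟩)
      (fun v w h => C.valid (by simpa using h)) hq
  · left
    refine (isContained_of_not_cliqueFree (G.induce (S : Set V)) hk hdegH hcf (t := t) ?_ ?_).trans
      ⟨(Embedding.induce (S : Set V)).toCopy⟩
    · rw [hcardS]
      linarith [hpow 1 (by norm_num), pow_one (k : ℝ)]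
    · rw [hcardS]
      -- The coefficient `8` in `ht` becomes the required `4` because `log |S| ≥ log n / 2`.
      refine four_pow_lt_of_le_log hS0 (by positivity) ?_ (by linarith)
      have : Real.log (8 * (k : ℝ) ^ 3) ≤ 8 * (k : ℝ) ^ 3 - 1 :=
        Real.log_le_sub_one_of_pos (by positivity)
      linarith [hpow 3 (by norm_num)]

end Main

end SignlessTuran

open SignlessTuran

theorem theorem2p6 (k : ℕ) (hk : 3 ≤ k) :
    ∃ c : ℝ, 0 < c ∧ ∃ n₀ : ℕ,
      ∀ (V : Type*) [Fintype V] [DecidableEq V] (G : SimpleGraph V) [DecidableRel G.Adj] (n : ℕ),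
        Fintype.card V = n → n₀ ≤ n →
        SignlessTuran.signlessRadius (SimpleGraph.turanGraph n k)
          ≤ SignlessTuran.signlessRadius G →
        ¬ Nonempty (G ≃g SimpleGraph.turanGraph n k) →
        ∃ t : ℕ, 2 ≤ t ∧ c * Real.log n ≤ t ∧
          (SignlessTuran.multipartitePlus k t).IsContained G := by
  have hK : (0 : ℝ) < ((8 * k ^ 3) ^ k : ℕ) := by
    have : 0 < (8 * k ^ 3) ^ k := by positivity
    exact_mod_cast this
  set K : ℝ := (((8 * k ^ 3) ^ k : ℕ) : ℝ) with hKdef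
  refine ⟨1 / (16 * K), by positivity, ⌈Real.exp (logThreshold k)⌉₊, ?_⟩
  rintro V _ _ G _ n rfl hn hq hiso
  have hexp : Real.exp (logThreshold k) ≤ Fintype.card V := Nat.ceil_le.1 hn
  have hlog : logThreshold k ≤ Real.log (Fintype.card V) :=
    (Real.le_log_iff_exp_le ((Real.exp_pos _).trans_le hexp)).2 hexp
  -- The summand `17K` of the threshold makes `c log n > 1`. Hence its ceiling is at least `2`, and
  -- rounding up at most doubles it, which is why `c` is `1/(16K)` and not `1/(8K)`.
  have h16 : 16 * K < Real.log (Fintype.card V) := by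
    refine lt_of_lt_of_le ?_ hlog
    rw [logThreshold, ← hKdef]
    have : (0 : ℝ) ≤ 1000 * (k : ℝ) ^ 5 := by positivity
    linarith
  have h1 : 1 < 1 / (16 * K) * Real.log (Fintype.card V) := by
    rw [one_div_mul_eq_div, lt_div_iff₀ (by positivity), one_mul]
    exact h16
  refine ⟨⌈1 / (16 * K) * Real.log (Fintype.card V)⌉₊, Nat.lt_ceil.2 (by exact_mod_cast h1),
    Nat.le_ceil _, (isContained_or_nonempty_iso G hk hlog hq ?_).resolve_right hiso⟩
  have h2 := (Nat.ceil_lt_add_one (show 0 ≤ 1 / (16 * K) * Real.log (Fintype.card V) by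
    linarith)).le
  rw [← hKdef]
  calc 8 * K * (⌈1 / (16 * K) * Real.log (Fintype.card V)⌉₊ : ℝ) ≤
        8 * K * (2 * (1 / (16 * K) * Real.log (Fintype.card V))) := by gcongr; linarith
    _ = Real.log (Fintype.card V) := by field_simp; norm_num
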